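/- Consider propositional modal logic with countably many propositional variables $p_0,p_1,\dots$ and one modality $\Box$ (with $\Diamond=\neg\Box\neg$). A normal modal logic is a set of formulas that contains all classical propositional tautologies and $\Box(p_0\to p_1)\to(\Box p_0\to\Box p_1)$ and is closed under modus ponens, uniform substitution and necessitation; it is consistent if it does not contain $\bot$. The normal modal logics form a complete lattice under inclusion. A normal modal logic $\mathsf L_2$ is a splitting of this lattice if there is a normal modal logic $\mathsf L_1$ such that for every normal modal logic $\mathsf L$ either $\mathsf L\subseteq \mathsf L_1$ or $\mathsf L_2\subseteq \mathsf L$, but not both. A normal modal logic is a join-splitting if it is the join of a (possibly empty) family of splittings. A $\mathcal V$-BAO is a Boolean algebra with a unary operation $\Diamond$ that preserves finite joins (including $\bot$) and is completely additive: for every set $X$ of elements whose join $\bigvee X$ exists, $\bigvee\{\Diamond x\mid x\in X\}$ exists and $\Diamond\bigvee X=\bigvee\{\Diamond x\mid x\in X\}$. A logic is valid over such an algebra if each of its formulas takes the value $\top$ under every assignment of elements to the variables. The degree of $\mathcal V$-incompleteness of a normal modal logic $\mathsf L$ is the cardinality of the set of normal modal logics $\mathsf L'$ such that $\mathsf L$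 and $\mathsf L'$ are valid over exactly the same $\mathcal V$-BAOs. Theorem (Blok Dichotomy for $\mathcal V$-incompleteness). If a consistent normal modal logic $\mathsf L$ is not a join-splitting of the lattice of normal modal logics, then $\mathsf L$ has degree of $\mathcal V$-incompleteness $2^{\aleph_0}$. -/

import Mathlib

universe u

namespace ModalLogic

/-- Formulas of propositional unimodal logic over the variables `p₀, p₁, …`. The connectives
`⊥`, `→`, `□` are taken as primitive, the others are abbreviations. -/
inductive Formula : Type
  | var : ℕ → Formula
  | bot : Formula
  | imp : Formula → Formula → Formula
  | box : Formula → Formula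

namespace Formula

def neg (φ : Formula) : Formula := imp φ bot

def top : Formula := neg bot

def or (φ ψ : Formula) : Formula := imp (neg φ) ψ

def and (φ ψ : Formula) : Formula := neg (imp φ (neg ψ))

def dia (φ : Formula) : Formula := neg (box (neg φ))

/-- Uniform (simultaneous) substitution of formulas for variables. -/
def subst (s : ℕ → Formula) : Formula → Formula
  | var n => s n
  | bot => bot
  | imp φ ψ => imp (subst s φ) (subst s ψ)
  | box φ => box (subst s φ)

/-- Classical truth value of a formula, where variables and formulas `□φ` are treated as atoms
whose truth values are given by `v`. -/
def Truth (v : Formula → Prop) : Formula → Prop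
  | var n => v (var n)
  | bot => False
  | imp φ ψ => Truth v φ → Truth v ψ
  | box φ => v (box φ)

/-- Tautologies of classical propositional logic (in the modal language). -/
def IsTautology (φ : Formula) : Prop := ∀ v : Formula → Prop, Truth v φ

/-- The axiom `□(p₀ → p₁) → (□p₀ → □p₁)`. -/
def axiomK : Formula :=
  imp (box (imp (var 0) (var 1))) (imp (box (var 0)) (box (var 1)))

end Formula

/-- A set of formulas is a normal modal logic. -/
structure IsNormalLogic (L : Set Formula) : Prop where
  tautology : ∀ φ, φ.IsTautology → φ ∈ L
  modusPonens : ∀ φ ψ, φ ∈ L → Formula.imp φ ψ ∈ L → ψ ∈ L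
  substitution : ∀ (s : ℕ → Formula) (φ), φ ∈ L → φ.subst s ∈ L
  necessitation : ∀ φ, φ ∈ L → Formula.box φ ∈ L
  axiomK_mem : Formula.axiomK ∈ L

/-- The type of normal (unimodal) logics, partially ordered by inclusion. -/
abbrev NormalLogic : Type := {L : Set Formula // IsNormalLogic L}

/-- A logic is consistent if it does not contain `⊥`. -/
def IsConsistent (L : NormalLogic) : Prop := Formula.bot ∉ L.1

/-- `⟨L₁, L₂⟩` is a splitting pair: every normal modal logic is either included in `L₁` or
includes `L₂`, but not both. -/
def IsSplittingPair (L₁ L₂ : NormalLogic) : Prop :=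
  ∀ L : NormalLogic, (L ≤ L₁ ∨ L₂ ≤ L) ∧ ¬ (L ≤ L₁ ∧ L₂ ≤ L)

/-- `L₂` is a splitting of the lattice of normal modal logics. -/
def IsSplitting (L₂ : NormalLogic) : Prop :=
  ∃ L₁ : NormalLogic, IsSplittingPair L₁ L₂

/-- `L` is a join-splitting: it is the join (the smallest normal modal logic that includes all
members) of a (possibly empty) family of splittings. -/
def IsJoinSplitting (L : NormalLogic) : Prop :=
  ∃ S : Set NormalLogic, (∀ M ∈ S, IsSplitting M) ∧ IsLUB S L

/-- Modal algebras: Boolean algebras with one unary operator `dia`, which preserves finite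
joins, including the empty one. -/
class ModalAlgebra (A : Type u) extends BooleanAlgebra A where
  dia : A → A
  dia_bot : dia ⊥ = ⊥
  dia_sup : ∀ a b : A, dia (a ⊔ b) = dia a ⊔ dia b

namespace ModalAlgebra

variable (A : Type u) [ModalAlgebra A]

/-- Complete additivity: `dia` preserves all joins that exist in `A`. -/
def IsCompletelyAdditive : Prop :=
  ∀ (X : Set A) (a : A), IsLUB X a → IsLUB (dia '' X) (dia a)

/-- The value of a formula in `A` under an assignment `θ` of elements of `A` to the variables. -/
def eval {A : Type u} [ModalAlgebra A] (θ : ℕ → A) : Formula → A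
  | .var n => θ n
  | .bot => ⊥
  | .imp φ ψ => (eval θ φ)ᶜ ⊔ eval θ ψ
  | .box φ => (dia (eval θ φ)ᶜ)ᶜ

/-- `A` validates `φ`: every assignment sends `φ` to the top element. -/
def Validates (φ : Formula) : Prop := ∀ θ : ℕ → A, eval θ φ = ⊤

/-- The logic `L` is valid over `A`. -/
def ValidatesLogic (L : NormalLogic) : Prop := ∀ φ ∈ L.1, Validates A φ

end ModalAlgebra

/-- `L` and `L'` are valid over exactly the same completely additive modal algebras. -/
def SameVBAOs (L L' : NormalLogic) : Prop :=
  ∀ (A : Type u) [ModalAlgebra A], ModalAlgebra.IsCompletelyAdditive A →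
    (ModalAlgebra.ValidatesLogic A L ↔ ModalAlgebra.ValidatesLogic A L')

/-- The degree of `V`-incompleteness of `L`: the cardinality of the set of all normal modal logics
that are valid over the same completely additive modal algebras as `L`. -/
noncomputable def degreeVIncompleteness (L : NormalLogic) : Cardinal.{0} :=
  Cardinal.mk {L' : NormalLogic // SameVBAOs.{u} L L'}

end ModalLogic

/-!
Let `L₀ ≤ L` be the closure of the union of all splittings below `L`, and let `φ` be a formula of
`L` outside `L₀`. Finite algebras validating `□ᵈ⊥` give splittings and logics containing `□ᵈ⊥` have
the finite model property, so `L` lies below every `L₀ ⊕ □ᵈ⊥`. Consequently the Lindenbaum algebra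
`A` of `L₀ ⊕ □ᵈ⊥`, for `d` the modal depth of `φ`, validates `L`, whereas the canonical frame of
`L₀`, unravelled up to level `d`, refutes `φ` at its root.

To the points of this tree from which level `d` can be reached (the others are absorbed in `A`) a
gadget is glued: the last level sees a hub, which sees the infinite sets of points of a descending
chain, so that the algebra is not completely additive, and from the chain finitely many links lead
back to the root. The points of the chain that see a distinguished tip code a set `I ⊆ ℕ`. Let `L_I`
be the intersection of `L` with the logic of this algebra. A formula saying that, wherever a theorem
of `L` fails, a hub can be reached whose infinite sets of successors behave in this way is valid in
the gadget, but in a completely additive algebra it forces the failure to be `⊥`. So `L_I` and `L`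
have the same completely additive algebras, while the refutation of `φ` in the gadget lets one read
off `I` from `L_I`. As there are only countably many formulas, there are no more than `2^ℵ₀` logics.

All of this needs a formula that defines the tip. If the irreflexive point validates `L`, the tip is
irreflexive and defined by `□⊥`. Otherwise the reflexive point does, the tip is reflexive and `A` is
trivial; every failure of a theorem of `L` then involves a variable whose value is neither `⊥` nor
`⊤`, from which a definition of the tip is obtained.
-/

namespace ModalLogic

open ModalAlgebra

namespace Formula

section Truth

variable (v : Formula → Prop) (φ ψ : Formula)

@[simp] theorem not_truth_bot : ¬ bot.Truth v := id

@[simp] theorem truth_imp : (φ.imp ψ).Truth v ↔ (φ.Truth v → ψ.Truth v) := Iff.rfl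

@[simp] theorem truth_box : φ.box.Truth v ↔ v φ.box := Iff.rfl

@[simp] theorem truth_neg : φ.neg.Truth v ↔ ¬ φ.Truth v := Iff.rfl

@[simp] theorem truth_top : top.Truth v := id

@[simp] theorem truth_or : (φ.or ψ).Truth v ↔ φ.Truth v ∨ ψ.Truth v :=
  or_iff_not_imp_left.symm

@[simp] theorem truth_and : (φ.and ψ).Truth v ↔ φ.Truth v ∧ ψ.Truth v := by
  simp [and]

@[simp] theorem truth_dia : φ.dia.Truth v ↔ ¬ v φ.neg.box := Iff.rfl

end Truth

theorem subst_var (φ : Formula) : φ.subst var = φ := by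
  induction φ with
  | var n => rfl
  | bot => rfl
  | imp φ ψ h₁ h₂ => rw [subst, h₁, h₂]
  | box φ ih => rw [subst, ih]

/-- A strict upper bound for the indices of the variables of a formula. -/
def varBound : Formula → ℕ
  | var n => n + 1
  | bot => 0
  | imp φ ψ => max (varBound φ) (varBound ψ)
  | box φ => varBound φ

theorem subst_congr {s t : ℕ → Formula} {φ : Formula} (h : ∀ n < φ.varBound, s n = t n) :
    φ.subst s = φ.subst t := by
  induction φ with
  | var n => exact h n (Nat.lt_succ_self n)
  | bot => rfl
  | imp φ ψ h₁ h₂ =>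
    rw [subst, subst, h₁ fun n hn => h n (lt_max_of_lt_left hn),
      h₂ fun n hn => h n (lt_max_of_lt_right hn)]
  | box φ ih => rw [subst, subst, ih h]

end Formula

section BooleanAlgebra

variable {A : Type*} [BooleanAlgebra A]

theorem compl_sup_eq_top_iff {a b : A} : aᶜ ⊔ b = ⊤ ↔ a ≤ b := by
  rw [sup_comm, ← himp_eq, himp_eq_top_iff]

theorem inf_le_iff_le_compl_sup {a b c : A} : a ⊓ b ≤ c ↔ a ≤ bᶜ ⊔ c := by
  rw [sup_comm, ← himp_eq, le_himp_iff]

theorem inf_eq_inf_of_le_biconditional {d a b : A} (h : d ≤ (aᶜ ⊔ b) ⊓ (bᶜ ⊔ a)) :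
    d ⊓ a = d ⊓ b :=
  le_antisymm (le_inf inf_le_left (inf_le_iff_le_compl_sup.2 (h.trans inf_le_left)))
    (le_inf inf_le_left (inf_le_iff_le_compl_sup.2 (h.trans inf_le_right)))

theorem inf_compl_congr {d a a' : A} (h : d ⊓ a = d ⊓ a') : d ⊓ aᶜ = d ⊓ a'ᶜ := by
  rw [← sdiff_eq, ← sdiff_eq, ← sdiff_inf_self_left, h, sdiff_inf_self_left]

theorem inf_compl_sup_congr {d a a' b b' : A} (h : d ⊓ a = d ⊓ a') (h' : d ⊓ b = d ⊓ b') :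
    d ⊓ (aᶜ ⊔ b) = d ⊓ (a'ᶜ ⊔ b') := by
  rw [inf_sup_left, inf_sup_left, inf_compl_congr h, h']

/-- Ultrafilters of a Boolean algebra, as the sets that decide joins and complements. -/
structure IsUltrafilter (U : Set A) : Prop where
  sup_mem_iff : ∀ a b, a ⊔ b ∈ U ↔ a ∈ U ∨ b ∈ U
  compl_mem_iff : ∀ a, aᶜ ∈ U ↔ a ∉ U

namespace IsUltrafilter

variable {U : Set A}

theorem top_mem (hU : IsUltrafilter U) : (⊤ : A) ∈ U := by
  rw [← sup_compl_eq_top (x := (⊤ : A)), hU.sup_mem_iff, hU.compl_mem_iff]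
  exact em _

theorem bot_notMem (hU : IsUltrafilter U) : (⊥ : A) ∉ U := by
  rw [← hU.compl_mem_iff, compl_bot]
  exact hU.top_mem

theorem mem_of_le (hU : IsUltrafilter U) {a b : A} (h : a ≤ b) (ha : a ∈ U) : b ∈ U := by
  rw [← sup_eq_right.2 h, hU.sup_mem_iff]
  exact Or.inl ha

theorem inf_mem_iff (hU : IsUltrafilter U) (a b : A) : a ⊓ b ∈ U ↔ a ∈ U ∧ b ∈ U := by
  rw [← compl_compl (a ⊓ b), compl_inf, hU.compl_mem_iff, hU.sup_mem_iff, hU.compl_mem_iff,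
    hU.compl_mem_iff, not_or, not_not, not_not]

end IsUltrafilter

theorem exists_isUltrafilter_disjoint (I : Order.Ideal A) {a : A} (ha : a ∉ I) :
    ∃ U : Set A, IsUltrafilter U ∧ a ∈ U ∧ ∀ b ∈ U, b ∉ I := by
  have hdisj : Disjoint (Order.PFilter.principal a : Set A) (I : Set A) :=
    Set.disjoint_left.2 fun b hab hb => ha (I.lower (Order.PFilter.mem_principal.1 hab) hb)
  obtain ⟨P, hP, hIP, haP⟩ := DistribLattice.prime_ideal_of_disjoint_filter_ideal hdisj
  refine ⟨{b | b ∉ P}, ⟨fun b c => ?_, fun b => ?_⟩, ?_, fun b hb hbI => hb (hIP hbI)⟩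
  · simp only [Set.mem_ofPred_eq, Order.Ideal.sup_mem_iff, not_and_or]
  · simp only [Set.mem_ofPred_eq, not_not]
    refine ⟨hP.mem_or_compl_mem.resolve_right, fun hb hbc => hP.toIsProper.top_notMem ?_⟩
    rw [← sup_compl_eq_top (x := b)]
    exact Order.Ideal.sup_mem hb hbc
  · exact Set.disjoint_left.1 haP (Order.PFilter.mem_principal.2 le_rfl)

theorem exists_isUltrafilter_mem {a : A} (ha : a ≠ ⊥) : ∃ U : Set A, IsUltrafilter U ∧ a ∈ U := by
  obtain ⟨U, hU, haU, -⟩ := exists_isUltrafilter_disjoint (Order.Ideal.principal ⊥)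
    (mt Order.Ideal.mem_principal.1 (mt le_bot_iff.1 ha))
  exact ⟨U, hU, haU⟩

theorem finite_booleanSubalgebra_closure {S : Set A} (hS : S.Finite) :
    (BooleanSubalgebra.closure S : Set A).Finite := by
  let T : Set A := latticeClosure (insert ⊥ (insert ⊤ S))
  have hT : T.Finite := ((hS.insert ⊤).insert ⊥).latticeClosure
  have hsub : insert ⊥ (insert ⊤ S) ⊆ T := subset_latticeClosure
  have := hT.to_subtype
  refine (Set.finite_range fun t : Finset (T × T) => t.sup fun x => x.1.1 \ x.2.1).subset
    fun a ha => ?_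
  have ha' : a ∈ BooleanSubalgebra.closure T := BooleanSubalgebra.closure_mono
    (((Set.subset_insert _ _).trans (Set.subset_insert _ _)).trans hsub) ha
  obtain ⟨t, rfl⟩ := (BooleanSubalgebra.mem_closure_iff_sup_sdiff isSublattice_latticeClosure
    (hsub (by simp)) (hsub (by simp))).1 ha'
  exact ⟨t, rfl⟩

end BooleanAlgebra

namespace ModalAlgebra

section Operators

variable {A : Type*} [ModalAlgebra A]

theorem dia_mono {a b : A} (h : a ≤ b) : dia a ≤ dia b := by
  rw [← sup_eq_right.2 h, dia_sup]
  exact le_sup_left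

/-- The box operator, dual to `dia`. -/
def nec (a : A) : A := (dia aᶜ)ᶜ

theorem compl_nec (a : A) : (nec a)ᶜ = dia aᶜ := compl_compl _

theorem nec_mono {a b : A} (h : a ≤ b) : nec a ≤ nec b :=
  compl_le_compl (dia_mono (compl_le_compl h))

theorem nec_top : nec (⊤ : A) = ⊤ := by simp [nec, dia_bot]

theorem nec_inf (a b : A) : nec (a ⊓ b) = nec a ⊓ nec b := by
  simp [nec, compl_inf, dia_sup, compl_sup]

theorem nec_iterate_top (n : ℕ) : nec^[n] (⊤ : A) = ⊤ :=
  Function.iterate_fixed nec_top n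

theorem nec_iterate_inf (n : ℕ) (a b : A) : nec^[n] (a ⊓ b) = nec^[n] a ⊓ nec^[n] b := by
  induction n generalizing a b with
  | zero => rfl
  | succ n ih => simp only [Function.iterate_succ_apply, nec_inf, ih]

theorem nec_iterate_mono (n : ℕ) {a b : A} (h : a ≤ b) : nec^[n] a ≤ nec^[n] b :=
  Monotone.iterate (fun _ _ => nec_mono) n h

/-- The element `□ⁿ⊥`, the part of an algebra of depth less than or equal to `n`. -/
def necBot (A : Type*) [ModalAlgebra A] (n : ℕ) : A := nec^[n] ⊥

theorem necBot_zero : necBot A 0 = ⊥ := rfl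

theorem necBot_succ (n : ℕ) : necBot A (n + 1) = nec (necBot A n) :=
  Function.iterate_succ_apply' _ _ _

theorem necBot_mono : Monotone (necBot A) := by
  refine monotone_nat_of_le_succ fun n => ?_
  induction n with
  | zero => exact bot_le
  | succ n ih => rw [necBot_succ, necBot_succ (n + 1)]; exact nec_mono ih

/-- The element `◇ⁿ⊤`. -/
def diaTop (A : Type*) [ModalAlgebra A] (n : ℕ) : A := dia^[n] ⊤

theorem diaTop_succ (n : ℕ) : diaTop A (n + 1) = dia (diaTop A n) :=
  Function.iterate_succ_apply' _ _ _

theorem compl_necBot (n : ℕ) : (necBot A n)ᶜ = diaTop A n := by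
  induction n with
  | zero => exact compl_bot
  | succ n ih => rw [necBot_succ, diaTop_succ, compl_nec, ih]

theorem diaTop_succ_le (n : ℕ) : diaTop A (n + 1) ≤ diaTop A n := by
  rw [← compl_necBot, ← compl_necBot]
  exact compl_le_compl (necBot_mono n.le_succ)

/-- The element `a ∨ ◇a ∨ ⋯ ∨ ◇ⁿa`. -/
def reach : ℕ → A → A
  | 0, a => a
  | n + 1, a => a ⊔ dia (reach n a)

theorem reach_mono (n : ℕ) {a b : A} (h : a ≤ b) : reach n a ≤ reach n b := by
  induction n with
  | zero => exact h
  | succ n ih => exact sup_le_sup h (dia_mono ih)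

theorem reach_bot (n : ℕ) : reach n (⊥ : A) = ⊥ := by
  induction n with
  | zero => rfl
  | succ n ih => rw [reach, ih, dia_bot, sup_bot_eq]

theorem le_reach (n : ℕ) (a : A) : a ≤ reach n a := by
  cases n with
  | zero => exact le_rfl
  | succ n => exact le_sup_left

theorem reach_le_reach {m n : ℕ} (h : m ≤ n) (a : A) : reach m a ≤ reach n a := by
  refine monotone_nat_of_le_succ (f := fun n => reach n a) (fun n => ?_) h
  induction n with
  | zero => exact le_sup_left
  | succ n ih => exact sup_le_sup le_rfl (dia_mono ih)

theorem dia_le_reach_succ {n : ℕ} {a b : A} (h : b ≤ reach n a) : dia b ≤ reach (n + 1) a :=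
  (dia_mono h).trans le_sup_right

theorem reach_le_reach_add {n : ℕ} {a b : A} (m : ℕ) (h : b ≤ reach n a) :
    reach m b ≤ reach (m + n) a := by
  induction m with
  | zero => simpa only [reach, Nat.zero_add] using h
  | succ m ih =>
    refine sup_le (h.trans (reach_le_reach (by omega) a)) ?_
    rw [Nat.succ_add]
    exact dia_le_reach_succ ih

/-- The accessibility relation of the canonical frame of a modal algebra. -/
def CanonicalRel (U V : Set A) : Prop := ∀ a ∈ V, dia a ∈ U

theorem exists_canonicalRel {U : Set A} (hU : IsUltrafilter U) {a : A} (ha : dia a ∈ U) :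
    ∃ V : Set A, IsUltrafilter V ∧ CanonicalRel U V ∧ a ∈ V := by
  let I : Order.Ideal A :=
    { carrier := {b | dia b ∉ U}
      lower' := fun b c hcb hb hc => hb (hU.mem_of_le (dia_mono hcb) hc)
      nonempty' := ⟨⊥, by simpa only [Set.mem_ofPred_eq, dia_bot] using hU.bot_notMem⟩
      directed' := fun b hb c hc => ⟨b ⊔ c, by
        simp only [Set.mem_ofPred_eq, dia_sup, hU.sup_mem_iff, not_or] at hb hc ⊢
        exact ⟨hb, hc⟩, le_sup_left, le_sup_right⟩ }
  obtain ⟨V, hV, haV, hVI⟩ := exists_isUltrafilter_disjoint I (a := a) (not_not.2 ha)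
  exact ⟨V, hV, fun b hb => not_not.1 (hVI b hb), haV⟩

theorem inf_nec_congr {d a a' : A} (hd : d ≤ nec d) (h : d ⊓ a = d ⊓ a') :
    d ⊓ nec a = d ⊓ nec a' := by
  rw [← inf_eq_left.2 hd, inf_assoc, inf_assoc, ← nec_inf, ← nec_inf, h]

end Operators

section Eval

variable {A : Type*} [ModalAlgebra A] (θ : ℕ → A) (φ ψ : Formula)

@[simp] theorem eval_var (n : ℕ) : eval θ (.var n) = θ n := rfl

@[simp] theorem eval_bot : eval θ .bot = ⊥ := rfl

@[simp] theorem eval_imp : eval θ (.imp φ ψ) = (eval θ φ)ᶜ ⊔ eval θ ψ := rfl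

@[simp] theorem eval_box : eval θ (.box φ) = nec (eval θ φ) := rfl

@[simp] theorem eval_neg : eval θ φ.neg = (eval θ φ)ᶜ := by simp [Formula.neg]

@[simp] theorem eval_top : eval θ .top = ⊤ := by simp [Formula.top]

@[simp] theorem eval_or : eval θ (φ.or ψ) = eval θ φ ⊔ eval θ ψ := by simp [Formula.or]

@[simp] theorem eval_and : eval θ (φ.and ψ) = eval θ φ ⊓ eval θ ψ := by simp [Formula.and]

@[simp] theorem eval_dia : eval θ φ.dia = dia (eval θ φ) := by simp [Formula.dia, nec]

@[simp] theorem eval_box_iterate (n : ℕ) : eval θ (Formula.box^[n] φ) = nec^[n] (eval θ φ) := by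
  induction n with
  | zero => rfl
  | succ n ih => rw [Function.iterate_succ_apply', Function.iterate_succ_apply', eval_box, ih]

theorem eval_subst (s : ℕ → Formula) :
    eval θ (φ.subst s) = eval (fun n => eval θ (s n)) φ := by
  induction φ with
  | var n => rfl
  | bot => rfl
  | imp φ ψ h₁ h₂ => rw [Formula.subst, eval_imp, eval_imp, h₁, h₂]
  | box φ h => rw [Formula.subst, eval_box, eval_box, h]

variable {θ φ}

theorem eval_congr {η : ℕ → A} (h : ∀ n < φ.varBound, θ n = η n) : eval θ φ = eval η φ := by
  induction φ with
  | var n => exact h n (Nat.lt_succ_self n)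
  | bot => rfl
  | imp φ ψ h₁ h₂ =>
    rw [eval_imp, eval_imp, h₁ fun n hn => h n (lt_max_of_lt_left hn),
      h₂ fun n hn => h n (lt_max_of_lt_right hn)]
  | box φ ih => rw [eval_box, eval_box, ih h]

theorem inf_eval_comp {M : Type*} [ModalAlgebra M] {d : M} (hd : d ≤ nec d) (f : A → M)
    (hbot : d ⊓ f ⊥ = ⊥) (himp : ∀ a b, d ⊓ f (aᶜ ⊔ b) = d ⊓ ((f a)ᶜ ⊔ f b))
    (hnec : ∀ a, d ⊓ f (nec a) = d ⊓ nec (f a)) (θ : ℕ → A) (φ : Formula) :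
    d ⊓ eval (fun n => f (θ n)) φ = d ⊓ f (eval θ φ) := by
  induction φ with
  | var n => rfl
  | bot => rw [eval_bot, eval_bot, hbot, inf_bot_eq]
  | imp φ ψ h₁ h₂ => rw [eval_imp, eval_imp, himp, inf_compl_sup_congr h₁ h₂]
  | box φ h => rw [eval_box, eval_box, hnec, inf_nec_congr hd h]

theorem eval_comp {M : Type*} [ModalAlgebra M] (f : A → M) (hbot : f ⊥ = ⊥)
    (himp : ∀ a b, f (aᶜ ⊔ b) = (f a)ᶜ ⊔ f b) (hnec : ∀ a, f (nec a) = nec (f a)) (θ : ℕ → A)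
    (φ : Formula) : eval (fun n => f (θ n)) φ = f (eval θ φ) := by
  simpa only [top_inf_eq] using inf_eval_comp (d := (⊤ : M)) nec_top.ge f (by rw [hbot, inf_bot_eq])
    (fun a b => by rw [himp]) (fun a => by rw [hnec]) θ φ

theorem truth_iff_eval_mem {U : Set A} (hU : IsUltrafilter U) (θ : ℕ → A) (φ : Formula) :
    φ.Truth (fun ψ => eval θ ψ ∈ U) ↔ eval θ φ ∈ U := by
  induction φ with
  | var n => rfl
  | bot => exact (iff_false_intro hU.bot_notMem).symm
  | imp φ ψ h₁ h₂ =>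
    rw [Formula.truth_imp, h₁, h₂, eval_imp, hU.sup_mem_iff, hU.compl_mem_iff,
      imp_iff_not_or]
  | box φ _ => rfl

theorem eval_eq_top_of_isTautology (hφ : φ.IsTautology) (θ : ℕ → A) : eval θ φ = ⊤ := by
  by_contra h
  obtain ⟨U, hU, hmem⟩ := exists_isUltrafilter_mem (mt compl_eq_bot.1 h)
  exact (hU.compl_mem_iff _).1 hmem ((truth_iff_eval_mem hU θ φ).1 (hφ _))

/-- The logic of the part of an algebra that is accessible from `r`. -/
def rootLogic (r : A) : NormalLogic where
  val := {φ | ∀ (θ : ℕ → A) (n : ℕ), r ≤ nec^[n] (eval θ φ)}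
  property :=
    { tautology := fun φ h θ n => by
        rw [eval_eq_top_of_isTautology h, nec_iterate_top]
        exact le_top
      modusPonens := fun φ ψ hφ hφψ θ n => by
        refine (le_inf (hφψ θ n) (hφ θ n)).trans ?_
        rw [← nec_iterate_inf]
        exact nec_iterate_mono n (inf_le_iff_le_compl_sup.2 le_rfl)
      substitution := fun s φ h θ n => by
        rw [eval_subst]
        exact h _ n
      necessitation := fun φ h θ n => h θ (n + 1)
      axiomK_mem := fun θ n => by
        suffices h : eval θ Formula.axiomK = ⊤ by rw [h, nec_iterate_top]; exact le_top
        simp only [Formula.axiomK, eval_imp, eval_box, eval_var]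
        rw [compl_sup_eq_top_iff, ← inf_le_iff_le_compl_sup, ← nec_inf]
        exact nec_mono (inf_le_iff_le_compl_sup.2 le_rfl) }

theorem mem_rootLogic_top : φ ∈ (rootLogic (⊤ : A)).1 ↔ Validates A φ :=
  ⟨fun h θ => top_le_iff.1 (h θ 0), fun h θ n => by rw [h θ, nec_iterate_top]⟩

end Eval

end ModalAlgebra

theorem isNormalLogic_sInter {𝓛 : Set (Set Formula)} (h : ∀ L ∈ 𝓛, IsNormalLogic L) :
    IsNormalLogic (⋂₀ 𝓛) where
  tautology φ hφ L hL := (h L hL).tautology φ hφ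
  modusPonens φ ψ h₁ h₂ L hL := (h L hL).modusPonens φ ψ (h₁ L hL) (h₂ L hL)
  substitution s φ hφ L hL := (h L hL).substitution s φ (hφ L hL)
  necessitation φ hφ L hL := (h L hL).necessitation φ (hφ L hL)
  axiomK_mem L hL := (h L hL).axiomK_mem

/-- The smallest normal logic that includes a set of formulas. -/
def normalClosure (Γ : Set Formula) : NormalLogic :=
  ⟨⋂₀ {L | IsNormalLogic L ∧ Γ ⊆ L}, isNormalLogic_sInter fun _ hL => hL.1⟩

theorem subset_normalClosure (Γ : Set Formula) : Γ ⊆ (normalClosure Γ).1 :=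
  Set.subset_sInter fun _ hL => hL.2

theorem normalClosure_le {Γ : Set Formula} {L : NormalLogic} (h : Γ ⊆ L.1) :
    normalClosure Γ ≤ L :=
  Set.sInter_subset_of_mem ⟨L.2, h⟩

/-- Theories: sets of formulas closed under the rules of normal logics other than substitution.
They are what is needed to form a Lindenbaum algebra. -/
structure IsTheory (T : Set Formula) : Prop where
  tautology : ∀ φ, φ.IsTautology → φ ∈ T
  modusPonens : ∀ φ ψ, φ ∈ T → Formula.imp φ ψ ∈ T → ψ ∈ T
  necessitation : ∀ φ, φ ∈ T → Formula.box φ ∈ T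
  box_imp_mem : ∀ φ ψ : Formula, ((φ.imp ψ).box.imp (φ.box.imp ψ.box)) ∈ T

theorem IsNormalLogic.isTheory {L : Set Formula} (h : IsNormalLogic L) : IsTheory L where
  tautology := h.tautology
  modusPonens := h.modusPonens
  necessitation := h.necessitation
  box_imp_mem φ ψ := h.substitution (fun n => if n = 0 then φ else ψ) _ h.axiomK_mem

theorem IsNormalLogic.isTheory_preimage_subst {L : Set Formula} (h : IsNormalLogic L)
    (s : ℕ → Formula) : IsTheory {φ | φ.subst s ∈ L} where
  tautology φ hφ := h.substitution s φ (h.tautology φ hφ)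
  modusPonens _ _ h₁ h₂ := h.modusPonens _ _ h₁ h₂
  necessitation _ hφ := h.necessitation _ hφ
  box_imp_mem _ _ := h.isTheory.box_imp_mem _ _

namespace IsTheory

variable {T : Set Formula}

theorem mem_of_imp (hT : IsTheory T) {φ ψ : Formula} (h : (φ.imp ψ).IsTautology) (hφ : φ ∈ T) :
    ψ ∈ T :=
  hT.modusPonens _ _ hφ (hT.tautology _ h)

theorem mem_of_imp_imp (hT : IsTheory T) {φ ψ χ : Formula}
    (h : (φ.imp (ψ.imp χ)).IsTautology) (hφ : φ ∈ T) (hψ : ψ ∈ T) : χ ∈ T :=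
  hT.modusPonens _ _ hψ (hT.mem_of_imp h hφ)

theorem imp_trans_mem (hT : IsTheory T) {φ ψ χ : Formula} (h₁ : φ.imp ψ ∈ T)
    (h₂ : ψ.imp χ ∈ T) : φ.imp χ ∈ T :=
  hT.mem_of_imp_imp (fun v => by aesop) h₁ h₂

theorem box_imp_box_mem (hT : IsTheory T) {φ ψ : Formula} (h : φ.imp ψ ∈ T) :
    φ.box.imp ψ.box ∈ T :=
  hT.modusPonens _ _ (hT.necessitation _ h) (hT.box_imp_mem φ ψ)

theorem neg_imp_neg_mem (hT : IsTheory T) {φ ψ : Formula} (h : φ.imp ψ ∈ T) :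
    ψ.neg.imp φ.neg ∈ T :=
  hT.mem_of_imp (fun v => by aesop) h

theorem dia_imp_dia_mem (hT : IsTheory T) {φ ψ : Formula} (h : φ.imp ψ ∈ T) :
    φ.dia.imp ψ.dia ∈ T :=
  hT.neg_imp_neg_mem (hT.box_imp_box_mem (hT.neg_imp_neg_mem h))

theorem dia_or_imp_mem (hT : IsTheory T) (φ ψ : Formula) :
    (φ.or ψ).dia.imp (φ.dia.or ψ.dia) ∈ T := by
  have h : φ.neg.box.imp (ψ.neg.imp (φ.or ψ).neg).box ∈ T :=
    hT.box_imp_box_mem (hT.tautology _ fun v => by aesop)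
  refine hT.mem_of_imp (fun v => ?_) (hT.imp_trans_mem h (hT.box_imp_mem _ _))
  simp only [Formula.truth_imp, Formula.truth_box, Formula.truth_or, Formula.truth_dia]
  tauto

theorem dia_bot_imp_mem (hT : IsTheory T) : Formula.bot.dia.imp .bot ∈ T :=
  hT.mem_of_imp (fun v => by aesop) (hT.necessitation Formula.bot.neg
    (hT.tautology _ fun v => by aesop))

/-- Provable equivalence. -/
def setoid (hT : IsTheory T) : Setoid Formula where
  r φ ψ := φ.imp ψ ∈ T ∧ ψ.imp φ ∈ T
  iseqv :=
    { refl := fun _ => ⟨hT.tautology _ fun _ => id, hT.tautology _ fun _ => id⟩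
      symm := And.symm
      trans := fun h₁ h₂ => ⟨hT.imp_trans_mem h₁.1 h₂.1, hT.imp_trans_mem h₂.2 h₁.2⟩ }

/-- The Lindenbaum algebra of a theory: formulas up to provable equivalence. -/
def Lindenbaum (hT : IsTheory T) : Type := Quotient hT.setoid

namespace Lindenbaum

/-- The class of a formula in the Lindenbaum algebra. -/
def mk (hT : IsTheory T) (φ : Formula) : hT.Lindenbaum := Quotient.mk hT.setoid φ

variable (hT : IsTheory T)

theorem mk_surjective : Function.Surjective (mk hT) := Quotient.exists_rep

theorem mk_eq_mk {φ ψ : Formula} : mk hT φ = mk hT ψ ↔ φ.imp ψ ∈ T ∧ ψ.imp φ ∈ T :=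
  ⟨Quotient.exact, fun h => Quotient.sound h⟩

instance : PartialOrder hT.Lindenbaum where
  le := Quotient.lift₂ (fun φ ψ => φ.imp ψ ∈ T) fun _ _ _ _ h₁ h₂ => propext
    ⟨fun h => hT.imp_trans_mem h₁.2 (hT.imp_trans_mem h h₂.1),
      fun h => hT.imp_trans_mem h₁.1 (hT.imp_trans_mem h h₂.2)⟩
  le_refl := by rintro ⟨φ⟩; exact hT.tautology _ fun _ => id
  le_trans := by rintro ⟨φ⟩ ⟨ψ⟩ ⟨χ⟩ h₁ h₂; exact hT.imp_trans_mem h₁ h₂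
  le_antisymm := by rintro ⟨φ⟩ ⟨ψ⟩ h₁ h₂; exact Quotient.sound ⟨h₁, h₂⟩

instance : Lattice hT.Lindenbaum where
  sup := Quotient.map₂ Formula.or fun _ _ h₁ _ _ h₂ =>
    ⟨hT.mem_of_imp_imp (fun v => by aesop) h₁.1 h₂.1,
      hT.mem_of_imp_imp (fun v => by aesop) h₁.2 h₂.2⟩
  inf := Quotient.map₂ Formula.and fun _ _ h₁ _ _ h₂ =>
    ⟨hT.mem_of_imp_imp (fun v => by aesop) h₁.1 h₂.1,
      hT.mem_of_imp_imp (fun v => by aesop) h₁.2 h₂.2⟩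
  le_sup_left := by rintro ⟨φ⟩ ⟨ψ⟩; exact hT.tautology _ fun v => by aesop
  le_sup_right := by rintro ⟨φ⟩ ⟨ψ⟩; exact hT.tautology _ fun v => by aesop
  sup_le := by rintro ⟨φ⟩ ⟨ψ⟩ ⟨χ⟩ h₁ h₂; exact hT.mem_of_imp_imp (fun v => by aesop) h₁ h₂
  inf_le_left := by rintro ⟨φ⟩ ⟨ψ⟩; exact hT.tautology _ fun v => by aesop
  inf_le_right := by rintro ⟨φ⟩ ⟨ψ⟩; exact hT.tautology _ fun v => by aesop
  le_inf := by rintro ⟨φ⟩ ⟨ψ⟩ ⟨χ⟩ h₁ h₂; exact hT.mem_of_imp_imp (fun v => by aesop) h₁ h₂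

instance : BooleanAlgebra hT.Lindenbaum where
  le_sup_inf := by rintro ⟨φ⟩ ⟨ψ⟩ ⟨χ⟩; exact hT.tautology _ fun v => by aesop
  compl := Quotient.map Formula.neg fun _ _ h => ⟨hT.neg_imp_neg_mem h.2, hT.neg_imp_neg_mem h.1⟩
  top := mk hT .top
  bot := mk hT .bot
  inf_compl_le_bot := by rintro ⟨φ⟩; exact hT.tautology _ fun v => by aesop
  top_le_sup_compl := by rintro ⟨φ⟩; exact hT.tautology _ fun v => by simp [em]
  le_top := by rintro ⟨φ⟩; exact hT.tautology _ fun v => by aesop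
  bot_le := by rintro ⟨φ⟩; exact hT.tautology _ fun v => by aesop

instance : ModalAlgebra hT.Lindenbaum where
  dia := Quotient.map Formula.dia fun _ _ h => ⟨hT.dia_imp_dia_mem h.1, hT.dia_imp_dia_mem h.2⟩
  dia_bot := (mk_eq_mk hT).2 ⟨hT.dia_bot_imp_mem, hT.tautology _ fun v => by aesop⟩
  dia_sup := by
    rintro ⟨φ⟩ ⟨ψ⟩
    have h₁ : φ.dia.imp (φ.or ψ).dia ∈ T :=
      hT.dia_imp_dia_mem (hT.tautology _ fun v => by aesop)
    have h₂ : ψ.dia.imp (φ.or ψ).dia ∈ T :=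
      hT.dia_imp_dia_mem (hT.tautology _ fun v => by aesop)
    exact (mk_eq_mk hT).2
      ⟨hT.dia_or_imp_mem φ ψ, hT.mem_of_imp_imp (fun v => by aesop) h₁ h₂⟩

theorem mk_imp (φ ψ : Formula) : mk hT (φ.imp ψ) = (mk hT φ)ᶜ ⊔ mk hT ψ :=
  (mk_eq_mk hT).2 ⟨hT.tautology _ fun v => by simp [imp_iff_not_or],
    hT.tautology _ fun v => by aesop⟩

theorem mk_box (φ : Formula) : mk hT φ.box = nec (mk hT φ) := by
  have h₁ : φ.neg.neg.box.imp φ.box ∈ T :=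
    hT.box_imp_box_mem (hT.tautology _ fun v => by aesop)
  have h₂ : φ.box.imp φ.neg.neg.box ∈ T :=
    hT.box_imp_box_mem (hT.tautology _ fun v => by aesop)
  exact (mk_eq_mk hT).2 ⟨hT.mem_of_imp (fun v => by aesop) h₂, hT.mem_of_imp (fun v => by aesop) h₁⟩

theorem mk_eq_top {φ : Formula} : mk hT φ = ⊤ ↔ φ ∈ T := by
  rw [← top_le_iff]
  exact ⟨hT.modusPonens _ _ (hT.tautology _ (Formula.truth_top ·)),
    hT.mem_of_imp fun v => by aesop⟩

theorem eval_mk (s : ℕ → Formula) (φ : Formula) :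
    eval (fun n => mk hT (s n)) φ = mk hT (φ.subst s) := by
  induction φ with
  | var n => rfl
  | bot => rfl
  | imp φ ψ h₁ h₂ => rw [eval_imp, h₁, h₂, Formula.subst, mk_imp]
  | box φ h => rw [eval_box, h, Formula.subst, mk_box]

theorem eval_mk_var (φ : Formula) : eval (fun n => mk hT (.var n)) φ = mk hT φ := by
  rw [eval_mk, Formula.subst_var]

theorem validates_iff {φ : Formula} :
    Validates hT.Lindenbaum φ ↔ ∀ s, φ.subst s ∈ T := by
  constructor
  · intro h s
    rw [← mk_eq_top hT, ← eval_mk]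
    exact h _
  · intro h θ
    choose s hs using fun n => mk_surjective hT (θ n)
    obtain rfl : (fun n => mk hT (s n)) = θ := funext hs
    rw [eval_mk, mk_eq_top]
    exact h s

end Lindenbaum

end IsTheory

/-- The Lindenbaum algebra of a normal logic. -/
abbrev NormalLogic.Lindenbaum (L : NormalLogic) : Type := L.2.isTheory.Lindenbaum

theorem validates_lindenbaum_iff (L : NormalLogic) {φ : Formula} :
    Validates L.Lindenbaum φ ↔ φ ∈ L.1 := by
  rw [IsTheory.Lindenbaum.validates_iff]
  exact ⟨fun h => φ.subst_var ▸ h .var, fun h s => L.2.substitution s φ h⟩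

theorem validatesLogic_lindenbaum (L : NormalLogic) : ValidatesLogic L.Lindenbaum L :=
  fun _ => (validates_lindenbaum_iff L).2

namespace Formula

/-- The conjunction of a list of formulas. -/
def all : List Formula → Formula
  | [] => top
  | φ :: l => φ.and (all l)

/-- The biconditional. -/
def iff (φ ψ : Formula) : Formula := (φ.imp ψ).and (ψ.imp φ)

/-- `hereditarily φ n` says that `φ` holds throughout the part of the model accessible from the
current point and that this part has depth less than `n`. -/
def hereditarily (φ : Formula) : ℕ → Formula
  | 0 => bot
  | n + 1 => φ.and (hereditarily φ n).box

section Diagram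

variable (A : Type*) [ModalAlgebra A] [Fintype A] (e : A → ℕ)

/-- The diagram of a finite modal algebra whose element `a` is named by the variable `e a`. -/
noncomputable def diagram : Formula :=
  all ((var (e ⊥)).neg ::
    (Finset.univ : Finset A).toList.map (fun a => (var (e (nec a))).iff (var (e a)).box) ++
    (Finset.univ : Finset (A × A)).toList.map
      (fun p => (var (e (p.1ᶜ ⊔ p.2))).iff ((var (e p.1)).imp (var (e p.2)))))

variable {A}

/-- The formula that fails at an ultrafilter containing `r` in a model of depth less than `d` on
the algebra `A`, and only in models that look like `A` from there on. -/
noncomputable def splitting (d : ℕ) (r : A) : Formula :=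
  ((var (e r)).and ((diagram A e).hereditarily d)).neg

end Diagram

/-- The formula `□ⁿ⊥`. -/
def boxBot : ℕ → Formula
  | 0 => bot
  | n + 1 => box (boxBot n)

theorem subst_boxBot (s : ℕ → Formula) (n : ℕ) : (boxBot n).subst s = boxBot n := by
  induction n with
  | zero => rfl
  | succ n ih => rw [boxBot, subst, ih]

end Formula

namespace ModalAlgebra

section Diagram

variable {M : Type*} [ModalAlgebra M] (θ : ℕ → M)

@[simp] theorem eval_boxBot (n : ℕ) : eval θ (.boxBot n) = necBot M n := by
  induction n with
  | zero => rfl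
  | succ n ih => rw [Formula.boxBot, eval_box, ih, necBot_succ]

theorem le_eval_all_iff {l : List Formula} {m : M} :
    m ≤ eval θ (.all l) ↔ ∀ φ ∈ l, m ≤ eval θ φ := by
  induction l with
  | nil => simp [Formula.all]
  | cons ψ l ih => rw [Formula.all, eval_and, le_inf_iff, ih, List.forall_mem_cons]

@[simp] theorem eval_iff (φ ψ : Formula) : eval θ (φ.iff ψ) =
    ((eval θ φ)ᶜ ⊔ eval θ ψ) ⊓ ((eval θ ψ)ᶜ ⊔ eval θ φ) := by simp [Formula.iff]

theorem eval_hereditarily_succ (φ : Formula) (n : ℕ) :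
    eval θ (φ.hereditarily (n + 1)) = eval θ φ ⊓ nec (eval θ (φ.hereditarily n)) :=
  eval_and ..

theorem eval_hereditarily_le (φ : Formula) (n : ℕ) :
    eval θ (φ.hereditarily n) ≤ eval θ φ := by
  cases n with
  | zero => exact bot_le
  | succ n => exact (eval_hereditarily_succ θ φ n).trans_le inf_le_left

theorem eval_hereditarily_le_nec (φ : Formula) (n : ℕ) :
    eval θ (φ.hereditarily n) ≤ nec (eval θ (φ.hereditarily n)) := by
  have hsucc : eval θ (φ.hereditarily n) ≤ eval θ (φ.hereditarily (n + 1)) := by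
    induction n with
    | zero => exact bot_le
    | succ n ih =>
      rw [eval_hereditarily_succ, eval_hereditarily_succ]
      exact inf_le_inf_left _ (nec_mono ih)
  exact hsucc.trans ((eval_hereditarily_succ θ φ n).trans_le inf_le_right)

theorem eval_hereditarily_of_eq_top {φ : Formula} (h : eval θ φ = ⊤) (n : ℕ) :
    eval θ (φ.hereditarily n) = necBot M n := by
  induction n with
  | zero => rfl
  | succ n ih => rw [eval_hereditarily_succ, h, ih, necBot_succ, top_inf_eq]

variable {A : Type*} [ModalAlgebra A] [Fintype A] {e : A → ℕ}

theorem le_eval_diagram_iff {m : M} :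
    m ≤ eval θ (.diagram A e) ↔ m ≤ (θ (e ⊥))ᶜ ∧
      (∀ a, m ≤ eval θ ((Formula.var (e (nec a))).iff (Formula.var (e a)).box)) ∧
      ∀ a b,
        m ≤ eval θ ((Formula.var (e (aᶜ ⊔ b))).iff ((Formula.var (e a)).imp (.var (e b)))) := by
  rw [Formula.diagram, le_eval_all_iff]
  simp only [List.cons_append, List.forall_mem_cons, List.forall_mem_append, List.forall_mem_map,
    Finset.mem_toList, Finset.mem_univ, true_implies, Prod.forall, eval_neg, eval_var]

theorem eval_diagram_eq_top {θ : ℕ → A} (hθ : ∀ a, θ (e a) = a) :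
    eval θ (.diagram A e) = ⊤ := by
  rw [← top_le_iff, le_eval_diagram_iff]
  simp only [eval_iff, eval_imp, eval_box, eval_var, hθ, compl_bot, compl_sup_eq_top, inf_top_eq,
    le_refl, implies_true, true_and]

theorem inf_eval_of_le_eval_diagram {θ : ℕ → M} {m : M} (hm : m ≤ nec m)
    (h : m ≤ eval θ (.diagram A e)) (η : ℕ → A) (ψ : Formula) :
    m ⊓ eval (fun n => θ (e (η n))) ψ = m ⊓ θ (e (eval η ψ)) := by
  obtain ⟨hbot, hnec, himp⟩ := (le_eval_diagram_iff θ).1 h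
  simp only [eval_iff] at hnec himp
  exact inf_eval_comp hm (fun a => θ (e a)) (le_compl_iff_disjoint_right.1 hbot).eq_bot
    (fun a b => inf_eq_inf_of_le_biconditional (himp a b))
    (fun a => inf_eq_inf_of_le_biconditional (hnec a)) η ψ

theorem eval_splitting {θ : ℕ → A} (hθ : ∀ a, θ (e a) = a) {d : ℕ} (hd : necBot A d = ⊤) (r : A) :
    eval θ (.splitting e d r) = rᶜ := by
  rw [Formula.splitting, eval_neg, eval_and, eval_var, hθ,
    eval_hereditarily_of_eq_top θ (eval_diagram_eq_top hθ), hd, inf_top_eq]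

theorem validates_splitting {ψ : Formula} (hψ : Validates M ψ) {r : A} {n : ℕ} {η : ℕ → A}
    (h : r ⊓ nec^[n] (eval η ψ) = ⊥) (d : ℕ) : Validates M (.splitting e d r) := by
  intro θ
  set m := eval θ ((Formula.diagram A e).hereditarily d) with hm
  have himage : ∀ η ψ, m ⊓ eval (fun n => θ (e (η n))) ψ = m ⊓ θ (e (eval η ψ)) :=
    inf_eval_of_le_eval_diagram (eval_hereditarily_le_nec θ _ d) (eval_hereditarily_le θ _ d)
  have hbot : m ⊓ θ (e ⊥) = ⊥ := by
    simpa only [eval_bot, inf_bot_eq] using (himage (fun _ => r) .bot).symm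
  have hψ' : m ≤ θ (e (nec^[n] (eval η ψ))) := by
    have := himage η (Formula.box^[n] ψ)
    rw [eval_box_iterate, eval_box_iterate, hψ, nec_iterate_top, inf_top_eq] at this
    exact inf_eq_left.1 this.symm
  have hr : m ⊓ (θ (e r) ⊓ θ (e (nec^[n] (eval η ψ)))) = ⊥ := by
    have := himage (fun i => if i = 0 then r else nec^[n] (eval η ψ))
      ((Formula.var 0).and (.var 1))
    simpa only [eval_and, eval_var, if_true, one_ne_zero, if_false, h, hbot] using this
  rw [Formula.splitting, eval_neg, eval_and, eval_var, ← hm, compl_eq_top, ← hr, inf_left_comm,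
    inf_eq_left.2 hψ']

end Diagram

end ModalAlgebra

theorem isSplittingPair_rootLogic {A : Type*} [ModalAlgebra A] [Fintype A] {e : A → ℕ}
    (he : Function.Injective e) {d : ℕ} (hd : necBot A d = ⊤) {r : A} (hr : IsAtom r) :
    IsSplittingPair (rootLogic r) (normalClosure {.splitting e d r}) := by
  refine fun L => ⟨?_, fun ⟨hle, hge⟩ => ?_⟩
  · by_cases hL : Formula.splitting e d r ∈ L.1
    · exact Or.inr (normalClosure_le (Set.singleton_subset_iff.2 hL))
    · refine Or.inl fun ψ hψ η n => by_contra fun h => hL ?_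
      exact (validates_lindenbaum_iff L).1 (validates_splitting (validatesLogic_lindenbaum L ψ hψ)
        (hr.not_le_iff_disjoint.1 h).eq_bot d)
  · have h := hle (hge (subset_normalClosure _ rfl)) (Function.invFun e) 0
    rw [Function.iterate_zero_apply, eval_splitting (Function.leftInverse_invFun he) hd,
      le_compl_self] at h
    exact hr.1 h

/-- The logic obtained from `L` by adding the axiom `□ᵈ⊥`. -/
def boundDepth (L : NormalLogic) (d : ℕ) : NormalLogic where
  val := {φ | (Formula.boxBot d).imp φ ∈ L.1}
  property :=
    { tautology := fun φ h => L.2.tautology _ fun v _ => h v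
      modusPonens := fun _ _ => L.2.isTheory.mem_of_imp_imp fun v => by aesop
      substitution := fun s φ h => by
        have := L.2.substitution s _ h
        rwa [Formula.subst, Formula.subst_boxBot] at this
      necessitation := fun φ h => by
        have hsucc : (Formula.boxBot d).imp (.boxBot (d + 1)) ∈ L.1 := by
          rw [← validates_lindenbaum_iff]
          intro θ
          rw [eval_imp, eval_boxBot, eval_boxBot, compl_sup_eq_top_iff]
          exact necBot_mono d.le_succ
        exact L.2.isTheory.imp_trans_mem hsucc (L.2.isTheory.box_imp_box_mem h)
      axiomK_mem := L.2.isTheory.mem_of_imp (fun _ h _ => h) L.2.axiomK_mem }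

theorem mem_boundDepth {L : NormalLogic} {d : ℕ} {φ : Formula} :
    φ ∈ (boundDepth L d).1 ↔ (Formula.boxBot d).imp φ ∈ L.1 := Iff.rfl

theorem le_boundDepth (L : NormalLogic) (d : ℕ) : L ≤ boundDepth L d := fun _ hφ =>
  L.2.isTheory.mem_of_imp (fun _ h _ => h) hφ

theorem boxBot_mem_boundDepth (L : NormalLogic) (d : ℕ) : .boxBot d ∈ (boundDepth L d).1 :=
  L.2.tautology _ fun _ => id

namespace ModalAlgebra

variable {A : Type*} [ModalAlgebra A]

theorem exists_finite_inf_necBot_eval {g : ℕ → A} (hg : (Set.range g).Finite) (j : ℕ) :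
    ∃ S : Set A, S.Finite ∧ ∀ φ, ∃ s ∈ S, necBot A j ⊓ eval g φ = necBot A j ⊓ s := by
  induction j with
  | zero => exact ⟨{⊥}, Set.finite_singleton _, fun φ => ⟨⊥, rfl, by simp [necBot_zero]⟩⟩
  | succ j ih =>
    obtain ⟨S, hS, h⟩ := ih
    let C := BooleanSubalgebra.closure (Set.range g ∪ nec '' S)
    have hC : Set.range g ∪ nec '' S ⊆ C := BooleanSubalgebra.subset_closure
    refine ⟨C, finite_booleanSubalgebra_closure (hg.union (hS.image nec)), fun φ => ?_⟩
    induction φ with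
    | var n => exact ⟨g n, hC (Or.inl ⟨n, rfl⟩), rfl⟩
    | bot => exact ⟨⊥, C.bot_mem, rfl⟩
    | imp φ ψ hφ hψ =>
      obtain ⟨a, ha, hφa⟩ := hφ
      obtain ⟨b, hb, hψb⟩ := hψ
      exact ⟨aᶜ ⊔ b, C.sup_mem (C.compl_mem ha) hb, inf_compl_sup_congr hφa hψb⟩
    | box φ _ =>
      obtain ⟨s, hs, hφs⟩ := h φ
      refine ⟨nec s, hC (Or.inr ⟨s, hs, rfl⟩), ?_⟩
      rw [necBot_succ, eval_box, ← nec_inf, ← nec_inf, hφs]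

theorem finite_of_finite_range_of_necBot_eq_top {g : ℕ → A} (hg : (Set.range g).Finite)
    (hsurj : Function.Surjective (eval g)) {d : ℕ} (hd : necBot A d = ⊤) : Finite A := by
  obtain ⟨S, hS, h⟩ := exists_finite_inf_necBot_eval hg d
  refine Set.finite_univ_iff.1 (hS.subset fun a _ => ?_)
  obtain ⟨φ, rfl⟩ := hsurj a
  obtain ⟨s, hs, hφs⟩ := h φ
  rw [hd, top_inf_eq, top_inf_eq] at hφs
  rwa [hφs]

end ModalAlgebra

theorem exists_finite_not_validates {L : NormalLogic} {d : ℕ} (hd : .boxBot d ∈ L.1) {φ : Formula}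
    (hφ : φ ∉ L.1) : ∃ (A : Type) (_ : ModalAlgebra A) (_ : Finite A),
      necBot A d = ⊤ ∧ ValidatesLogic A L ∧ ¬ Validates A φ := by
  let τ : ℕ → Formula := fun n => if n < φ.varBound then .var n else .bot
  have hT : IsTheory {ψ | ψ.subst τ ∈ L.1} := L.2.isTheory_preimage_subst τ
  let g : ℕ → hT.Lindenbaum := fun n => .mk hT (.var n)
  have heval : ∀ ψ, eval g ψ = .mk hT ψ := IsTheory.Lindenbaum.eval_mk_var hT
  have hg : (Set.range g).Finite := by
    refine (((Set.finite_lt_nat φ.varBound).image g).insert ⊥).subset ?_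
    rintro _ ⟨n, rfl⟩
    by_cases hn : n < φ.varBound
    · exact Or.inr ⟨n, hn, rfl⟩
    · refine Or.inl ((IsTheory.Lindenbaum.mk_eq_mk hT).2 ⟨?_, ?_⟩) <;>
      · simp only [Set.mem_ofPred_eq, Formula.subst, τ, hn, if_false]
        exact L.2.tautology _ fun _ => id
  have hdepth : necBot hT.Lindenbaum d = ⊤ := by
    rw [← eval_boxBot g, heval, IsTheory.Lindenbaum.mk_eq_top, Set.mem_ofPred_eq,
      Formula.subst_boxBot]
    exact hd
  refine ⟨hT.Lindenbaum, inferInstance, finite_of_finite_range_of_necBot_eq_top hg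
    (fun a => (IsTheory.Lindenbaum.mk_surjective hT a).imp fun ψ h => (heval ψ).trans h) hdepth,
    hdepth, fun ψ hψ => ?_, fun h => hφ ?_⟩
  · exact (IsTheory.Lindenbaum.validates_iff hT).2 fun s =>
      L.2.substitution τ _ (L.2.substitution s ψ hψ)
  · have := (IsTheory.Lindenbaum.validates_iff hT).1 h .var
    rwa [Formula.subst_var, Set.mem_ofPred_eq,
      Formula.subst_congr (t := .var) fun n hn => if_pos hn, Formula.subst_var] at this

theorem le_boundDepth_of_splittings {L L₀ : NormalLogic}
    (h : ∀ M, IsSplitting M → M ≤ L → M ≤ L₀) (d : ℕ) : L ≤ boundDepth L₀ d := by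
  intro φ hφ
  by_contra hφ₀
  obtain ⟨A, _, _, hd, hA, hAφ⟩ := exists_finite_not_validates (boxBot_mem_boundDepth L₀ d) hφ₀
  have := Fintype.ofFinite A
  obtain ⟨e, he⟩ := exists_injective_nat A
  obtain ⟨θ, hθ⟩ := not_forall.1 hAφ
  obtain ⟨r, hr, hrθ⟩ := (eq_bot_or_exists_atom_le (eval θ φ)ᶜ).resolve_left
    (mt compl_eq_bot.1 hθ)
  have hsplit := isSplittingPair_rootLogic he hd hr
  rcases (hsplit L).1 with hL | hL
  · have hrφ : r ≤ eval θ φ := hL hφ θ 0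
    exact hr.1 (le_bot_iff.1 ((le_inf hrφ hrθ).trans inf_compl_eq_bot.le))
  · have hmem : .splitting e d r ∈ L₀.1 := h _ ⟨_, hsplit⟩ hL (subset_normalClosure _ rfl)
    have hr' := hA _ (le_boundDepth L₀ d hmem) (Function.invFun e)
    rw [eval_splitting (Function.leftInverse_invFun he) hd, compl_eq_top] at hr'
    exact hr.1 hr'

theorem exists_not_le_of_not_isJoinSplitting {L : NormalLogic} (hL : ¬ IsJoinSplitting L) :
    ∃ L₀ : NormalLogic, (∀ M, IsSplitting M → M ≤ L → M ≤ L₀) ∧ ¬ L ≤ L₀ := by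
  let 𝓢 : Set NormalLogic := {M | IsSplitting M ∧ M ≤ L}
  have hmem : ∀ M ∈ 𝓢, M ≤ normalClosure (⋃ M ∈ 𝓢, M.1) := fun M hM =>
    (Set.subset_biUnion_of_mem (u := fun M : NormalLogic => M.1) hM).trans (subset_normalClosure _)
  refine ⟨normalClosure (⋃ M ∈ 𝓢, M.1), fun M hM hML => hmem M ⟨hM, hML⟩, fun hle => hL ?_⟩
  exact ⟨𝓢, fun M hM => hM.1, fun M hM => hM.2,
    fun N hN => hle.trans (normalClosure_le (Set.iUnion₂_subset fun M hM => hN hM))⟩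

/-- The complex algebra of the frame with a single point, which is reflexive iff `ρ`. -/
def SinglePoint (_ρ : Prop) : Type := Prop

namespace SinglePoint

instance (ρ : Prop) : BooleanAlgebra (SinglePoint ρ) := inferInstanceAs (BooleanAlgebra Prop)

instance (ρ : Prop) : ModalAlgebra (SinglePoint ρ) where
  dia p := (ρ ∧ p : Prop)
  dia_bot := propext (iff_of_eq (and_false _))
  dia_sup _ _ := propext and_or_left

variable {ρ : Prop}

theorem eq_top_or_eq_bot (p : SinglePoint ρ) : p = ⊤ ∨ p = ⊥ := by
  by_cases hp : (show Prop from p)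
  · exact Or.inl (eq_true hp)
  · exact Or.inr (eq_false hp)

theorem top_ne_bot : (⊤ : SinglePoint ρ) ≠ ⊥ := true_ne_false

theorem nec_eq_top (p : SinglePoint False) : nec p = ⊤ := eq_true fun h => h.1

theorem nec_eq_self (p : SinglePoint True) : nec p = p := by
  rw [nec, compl_eq_comm]
  exact (propext (iff_of_eq (true_and _))).symm

open Classical in
/-- The Boolean homomorphism from the two-element algebra to any other one. -/
noncomputable def toAlgebra (M : Type*) [ModalAlgebra M] (p : SinglePoint ρ) : M :=
  if p = (⊤ : SinglePoint ρ) then ⊤ else ⊥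

variable {M : Type*} [ModalAlgebra M]

@[simp] theorem toAlgebra_top : toAlgebra M (⊤ : SinglePoint ρ) = ⊤ := if_pos rfl

@[simp] theorem toAlgebra_bot : toAlgebra M (⊥ : SinglePoint ρ) = ⊥ := if_neg top_ne_bot.symm

theorem toAlgebra_compl_sup (p q : SinglePoint ρ) :
    toAlgebra M (pᶜ ⊔ q) = (toAlgebra M p)ᶜ ⊔ toAlgebra M q := by
  rcases eq_top_or_eq_bot p with rfl | rfl <;> rcases eq_top_or_eq_bot q with rfl | rfl <;> simp

theorem inf_eval_toAlgebra_of_irreflexive (θ : ℕ → SinglePoint False) (φ : Formula) :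
    nec ⊥ ⊓ eval (fun n => toAlgebra M (θ n)) φ = nec ⊥ ⊓ toAlgebra M (eval θ φ) := by
  refine inf_eval_comp (nec_mono bot_le) _ (by rw [toAlgebra_bot, inf_bot_eq])
    (fun p q => by rw [toAlgebra_compl_sup]) (fun p => ?_) θ φ
  rw [← nec_inf, bot_inf_eq, nec_eq_top, toAlgebra_top, inf_top_eq]

theorem eval_toAlgebra_of_reflexive (hM : nec (⊥ : M) = ⊥) (θ : ℕ → SinglePoint True)
    (φ : Formula) : eval (fun n => toAlgebra M (θ n)) φ = toAlgebra M (eval θ φ) := by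
  refine eval_comp _ toAlgebra_bot toAlgebra_compl_sup (fun p => ?_) θ φ
  rw [nec_eq_self]
  rcases eq_top_or_eq_bot p with rfl | rfl
  · rw [toAlgebra_top, nec_top]
  · rw [toAlgebra_bot, hM]

end SinglePoint

theorem neg_boxBot_one_mem {L : NormalLogic} (h : ¬ ValidatesLogic (SinglePoint False) L) :
    (Formula.boxBot 1).neg ∈ L.1 := by
  simp only [ValidatesLogic, Validates, not_forall] at h
  obtain ⟨φ, hφ, θ, hθ⟩ := h
  have hbot := SinglePoint.inf_eval_toAlgebra_of_irreflexive (M := L.Lindenbaum) θ φ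
  rw [validatesLogic_lindenbaum L φ hφ, (SinglePoint.eq_top_or_eq_bot _).resolve_left hθ,
    SinglePoint.toAlgebra_bot, inf_top_eq, inf_bot_eq] at hbot
  rw [← validates_lindenbaum_iff]
  intro η
  rw [eval_neg, eval_boxBot, necBot_succ, necBot_zero, hbot, compl_bot]

theorem validatesLogic_singlePoint_true {L : NormalLogic} (hL : IsConsistent L)
    (h : (Formula.boxBot 1).neg ∈ L.1) : ValidatesLogic (SinglePoint True) L := by
  refine fun φ hφ θ => (SinglePoint.eq_top_or_eq_bot _).resolve_right fun hθ => hL ?_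
  have hnec : nec (⊥ : L.Lindenbaum) = ⊥ := by
    have := validatesLogic_lindenbaum L _ h fun _ => ⊥
    rwa [eval_neg, eval_boxBot, necBot_succ, necBot_zero, compl_eq_top] at this
  have hφ' := SinglePoint.eval_toAlgebra_of_reflexive hnec θ φ
  rw [validatesLogic_lindenbaum L φ hφ, hθ, SinglePoint.toAlgebra_bot] at hφ'
  exact (validates_lindenbaum_iff L).1 fun _ => hφ'.symm

theorem bot_mem_boundDepth {L : NormalLogic} (h : (Formula.boxBot 1).neg ∈ L.1) (d : ℕ) :
    .bot ∈ (boundDepth L d).1 := by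
  rw [mem_boundDepth]
  induction d with
  | zero => exact L.2.tautology _ fun _ => id
  | succ d ih => exact L.2.isTheory.imp_trans_mem (L.2.isTheory.box_imp_box_mem ih) h

theorem validatesLogic_singlePoint_of_splittings {L L₀ : NormalLogic} (hL : IsConsistent L)
    (h : ∀ M, IsSplitting M → M ≤ L → M ≤ L₀) :
    ValidatesLogic (SinglePoint False) L ∨
      ValidatesLogic (SinglePoint True) L ∧ ∀ d, .bot ∈ (boundDepth L₀ d).1 := by
  refine or_iff_not_imp_left.2 fun hirr => ?_
  have hmem := neg_boxBot_one_mem hirr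
  refine ⟨validatesLogic_singlePoint_true hL hmem, bot_mem_boundDepth ?_⟩
  exact L₀.2.isTheory.mem_of_imp (fun v => by aesop) (le_boundDepth_of_splittings h 1 hmem)

section CompleteAdditivity

variable {M : Type*} [ModalAlgebra M]

theorem isLUB_reach (hM : IsCompletelyAdditive M) (n : ℕ) {X : Set M} {a : M} (h : IsLUB X a) :
    IsLUB (reach n '' X) (reach n a) := by
  induction n with
  | zero => rwa [show (reach 0 : M → M) = id from rfl, Set.image_id]
  | succ n ih =>
    constructor
    · rintro _ ⟨x, hx, rfl⟩
      exact reach_mono _ (h.1 hx)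
    · intro b hb
      refine sup_le (h.2 fun x hx => le_sup_left.trans (hb ⟨x, hx, rfl⟩)) ((hM _ _ ih).2 ?_)
      rintro _ ⟨_, ⟨x, hx, rfl⟩, rfl⟩
      exact le_sup_right.trans (hb ⟨x, hx, rfl⟩)

theorem exists_le_forall_inf_ne_bot {f : M → M}
    (hf : ∀ (X : Set M) (a : M), IsLUB X a → IsLUB (f '' X) (f a)) {x y : M} (h : x ⊓ f y ≠ ⊥) :
    ∃ z ≤ y, z ≠ ⊥ ∧ ∀ u ≤ z, u ≠ ⊥ → x ⊓ f u ≠ ⊥ := by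
  by_contra! hz
  have hlub : IsLUB {u : M | u ≤ y ∧ x ⊓ f u = ⊥} y := by
    refine ⟨fun u hu => hu.1, fun b hb => ?_⟩
    by_contra hyb
    obtain ⟨u, huz, hu, hxu⟩ := hz (y ⊓ bᶜ) inf_le_left
      (mt (fun h' => by rwa [← sdiff_eq, sdiff_eq_bot_iff] at h') hyb)
    have hub : u ≤ b := hb ⟨huz.trans inf_le_left, hxu⟩
    exact hu (le_bot_iff.1 (disjoint_compl_right hub (huz.trans inf_le_right)))
  have hfy : f y ≤ xᶜ := (hf _ _ hlub).2 <| by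
    rintro _ ⟨u, hu, rfl⟩
    rw [le_compl_iff_disjoint_left, disjoint_iff]
    exact hu.2
  exact h (disjoint_iff.1 (le_compl_iff_disjoint_left.1 hfy))

theorem eq_bot_of_forall_le_dia_inf_compl_dia {v : M} (h : ∀ u ≤ v, u ≤ dia (u ⊓ (dia u)ᶜ)) :
    v = ⊥ := by
  have hv : v ⊓ (dia v)ᶜ = ⊥ := by
    refine le_bot_iff.1 (disjoint_compl_right (a := dia v) ?_ inf_le_right)
    exact (h _ inf_le_left).trans (dia_mono (inf_le_left.trans inf_le_left))
  have hle := h v le_rfl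
  rwa [hv, dia_bot, le_bot_iff] at hle

theorem eq_bot_of_inf_dia_van_benthem (hM : IsCompletelyAdditive M) {y w : M} (hy : y ≤ dia w)
    (h : ∀ u ≤ w, y ⊓ dia (u ⊓ (dia (u ⊓ (dia u)ᶜ))ᶜ) = ⊥) : y = ⊥ := by
  by_contra hne
  obtain ⟨v, hvw, hv, hv'⟩ := exists_le_forall_inf_ne_bot (x := y) (y := w) hM
    (by rwa [inf_eq_left.2 hy])
  refine hv (eq_bot_of_forall_le_dia_inf_compl_dia fun u huv => ?_)
  by_contra hu
  refine hv' (u ⊓ (dia (u ⊓ (dia u)ᶜ))ᶜ) (inf_le_left.trans huv) ?_ (h u (huv.trans hvw))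
  rwa [← sdiff_eq, Ne, sdiff_eq_bot_iff]

/-- For `u ≤ w`, failure of van Benthem's axiom at `b` is the condition that `b` sees a `u`-point
which does not see any `u`-point that is blind to `u`. In a completely additive algebra it has to
occur for some `u` as soon as `b` is nonzero and sees `w`. -/
theorem eq_bot_of_van_benthem (hM : IsCompletelyAdditive M) {n : ℕ} {a b w : M}
    (hb : b ≤ dia w) (ha : a ≤ reach n b)
    (hu : ∀ u, a ≤ (reach n (b ⊓ dia (w ⊓ u ⊓ (dia (w ⊓ u ⊓ (dia (w ⊓ u))ᶜ))ᶜ)))ᶜ) : a = ⊥ := by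
  by_contra hne
  obtain ⟨y, hyb, hy, hy'⟩ := exists_le_forall_inf_ne_bot (x := a) (y := b)
    (fun X c h => isLUB_reach hM n h) (by rwa [inf_eq_left.2 ha])
  refine hy (eq_bot_of_inf_dia_van_benthem hM (hyb.trans hb) fun u huw => ?_)
  by_contra hyu
  refine hy' _ inf_le_left hyu (le_bot_iff.1 ?_)
  have hau := hu u
  rw [inf_eq_right.2 huw, le_compl_iff_disjoint_right, disjoint_iff] at hau
  exact hau ▸ inf_le_inf_left _ (reach_mono n (inf_le_inf_right _ hyb))

end CompleteAdditivity

namespace ModalAlgebra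

variable {M : Type*} [ModalAlgebra M]

/-- Starting from a point of `ladder c k`, any sequence of at most `k - 1` steps outside `c` stays
in `dia c`, and such sequences exist. -/
def ladder (c : M) : ℕ → M
  | 0 => ⊤
  | k + 1 => dia c ⊓ dia (cᶜ ⊓ ladder c k) ⊓ (dia (cᶜ ⊓ (ladder c k)ᶜ))ᶜ

/-- The points that see a point of `ladder c k`. -/
def region (c : M) (k : ℕ) : M := dia (ladder c k)

/-- The points outside `region c k` that see a point of `region c k`. -/
def entrance (c : M) (k : ℕ) : M := dia (region c k) ⊓ (region c k)ᶜ

/-- The points of `region c k` that start a path of length `n` within it. -/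
def height (c : M) (k : ℕ) : ℕ → M
  | 0 => region c k
  | n + 1 => region c k ⊓ dia (height c k n)

/-- The points of `region c k` of height exactly `n + 1` that see `c`. -/
def marked (c : M) (k n : ℕ) : M :=
  height c k (n + 1) ⊓ (height c k (n + 2))ᶜ ⊓ dia c

/-- The points of `entrance c k` at which van Benthem's axiom for `u` fails. -/
def defect (c : M) (k : ℕ) (u : M) : M :=
  entrance c k ⊓ dia (region c k ⊓ u ⊓ (dia (region c k ⊓ u ⊓ (dia (region c k ⊓ u))ᶜ))ᶜ)

theorem ladder_le_diaTop (c : M) (k : ℕ) : ladder c k ≤ diaTop M k := by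
  induction k with
  | zero => exact le_rfl
  | succ k ih =>
    rw [diaTop_succ]
    exact inf_le_left.trans (inf_le_right.trans (dia_mono (inf_le_right.trans ih)))

end ModalAlgebra

namespace Formula

/-- The formula for `ModalAlgebra.reach`. -/
def reach : ℕ → Formula → Formula
  | 0, φ => φ
  | n + 1, φ => φ.or (reach n φ).dia

/-- The formula for `ModalAlgebra.ladder`. -/
def ladder (c : Formula) : ℕ → Formula
  | 0 => top
  | k + 1 => (c.dia.and (c.neg.and (ladder c k)).dia).and (c.neg.and (ladder c k).neg).dia.neg

/-- The formula for `ModalAlgebra.region`. -/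
def region (c : Formula) (k : ℕ) : Formula := (ladder c k).dia

/-- The formula for `ModalAlgebra.entrance`. -/
def entrance (c : Formula) (k : ℕ) : Formula := (region c k).dia.and (region c k).neg

/-- The formula for `ModalAlgebra.height`. -/
def height (c : Formula) (k : ℕ) : ℕ → Formula
  | 0 => region c k
  | n + 1 => (region c k).and (height c k n).dia

/-- The formula for `ModalAlgebra.marked`. -/
def marked (c : Formula) (k n : ℕ) : Formula :=
  ((height c k (n + 1)).and (height c k (n + 2)).neg).and c.dia

/-- The formula for `ModalAlgebra.defect`. -/
def defect (c : Formula) (k : ℕ) (u : Formula) : Formula :=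
  (entrance c k).and (((region c k).and u).and
    (((region c k).and u).and ((region c k).and u).dia.neg).dia.neg).dia

end Formula

namespace ModalAlgebra

variable {M : Type*} [ModalAlgebra M] (θ : ℕ → M) (c u : Formula) (k n : ℕ)

@[simp] theorem eval_reach : eval θ (.reach n c) = reach n (eval θ c) := by
  induction n with
  | zero => rfl
  | succ n ih => simp [Formula.reach, reach, ih]

@[simp] theorem eval_ladder : eval θ (.ladder c k) = ladder (eval θ c) k := by
  induction k with
  | zero => simp [Formula.ladder, ladder]
  | succ k ih => simp [Formula.ladder, ladder, ih]

@[simp] theorem eval_region : eval θ (.region c k) = region (eval θ c) k := by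
  simp [Formula.region, region]

@[simp] theorem eval_entrance : eval θ (.entrance c k) = entrance (eval θ c) k := by
  simp [Formula.entrance, entrance]

@[simp] theorem eval_height : eval θ (.height c k n) = height (eval θ c) k n := by
  induction n with
  | zero => simp [Formula.height, height]
  | succ n ih => simp [Formula.height, height, ih]

@[simp] theorem eval_marked : eval θ (.marked c k n) = marked (eval θ c) k n := by
  simp [Formula.marked, marked]

@[simp] theorem eval_defect : eval θ (.defect c k u) = defect (eval θ c) k (eval θ u) := by
  simp [Formula.defect, defect]

end ModalAlgebra

/-- A tree whose branches all end at level `d`, together with a relation of its nodes to the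
elements of an algebra that is determined by ultrafilters: `sees t a` means that `t` sees an
ultrafilter containing `a`. -/
structure LeveledTree (A : Type*) [ModalAlgebra A] (d : ℕ) where
  Node : Type
  root : Node
  level : Node → ℕ
  rel : Node → Node → Prop
  sees : Node → A → Prop
  not_sees_bot : ∀ t, ¬ sees t ⊥
  sees_sup_iff : ∀ t a b, sees t (a ⊔ b) ↔ sees t a ∨ sees t b
  level_le : ∀ t, level t ≤ d
  level_of_rel : ∀ s t, rel s t → level t = level s + 1
  exists_rel : ∀ s, level s < d → ∃ t, rel s t
  eq_root : ∀ t, level t = 0 → t = root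
  exists_rel_left : ∀ t, level t ≠ 0 → ∃ s, rel s t

variable {A : Type*} [ModalAlgebra A] {d : ℕ}

/-- The points of a gadget: the nodes of a tree, the hub, an infinite chain, finitely many links
from the chain back to the root of the tree, and the tip. -/
inductive GadgetPoint (D : LeveledTree A d) : Type
  | tree (t : D.Node)
  | link (j : Fin (d + 3))
  | hub
  | chain (n : ℕ)
  | tip

/-- The accessibility relation between the points of a gadget, in which `I` is the set of the
positions at which the chain sees the tip, and `ρ` says whether the tip is reflexive. -/
inductive GadgetPoint.Rel {D : LeveledTree A d} (I : Set ℕ) (ρ : Prop) :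
    GadgetPoint D → GadgetPoint D → Prop
  | tree_tree {s t} : D.rel s t → Rel I ρ (.tree s) (.tree t)
  | tree_hub {t} : D.level t = d → Rel I ρ (.tree t) .hub
  | link_root : Rel I ρ (.link 0) (.tree D.root)
  | link_link (i : Fin (d + 2)) : Rel I ρ (.link i.succ) (.link i.castSucc)
  | link_tip (i : Fin (d + 2)) : Rel I ρ (.link i.succ) .tip
  | chain_chain {m n} : m < n → Rel I ρ (.chain n) (.chain m)
  | chain_link (n) : Rel I ρ (.chain n) (.link (Fin.last _))
  | chain_tip {i} : i ∈ I → Rel I ρ (.chain (i + 1)) .tip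
  | tip_tip : ρ → Rel I ρ .tip .tip

/-- The modal algebra that consists of all sets of points and an element of `A` each. The hub sees
the nonprincipal ultrafilters on the chain, which makes the algebra fail complete additivity. -/
def Gadget (D : LeveledTree A d) (_I : Set ℕ) (_ρ : Prop) : Type _ := Set (GadgetPoint D) × A

namespace Gadget

open GadgetPoint

variable {D : LeveledTree A d} {I : Set ℕ} {ρ : Prop}

instance : BooleanAlgebra (Gadget D I ρ) :=
  inferInstanceAs (BooleanAlgebra (Set (GadgetPoint D) × A))

/-- The relation that the element `x` of a gadget holds at the point `s`. -/
def Sat (x : Gadget D I ρ) (s : GadgetPoint D) : Prop := s ∈ x.1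

/-- The component of an element of a gadget in the algebra `A`. -/
def base (x : Gadget D I ρ) : A := x.2

theorem eq_of_forall_sat_iff {x y : Gadget D I ρ} (h : ∀ s, x.Sat s ↔ y.Sat s)
    (hbase : x.base = y.base) : x = y :=
  Prod.ext (Set.ext h) hbase

/-- The set of the points that see something in `x`. -/
def diaSet (x : Gadget D I ρ) : Set (GadgetPoint D) :=
  {s | (∃ t, Rel I ρ s t ∧ x.Sat t) ∨ (∃ t, s = .tree t ∧ D.sees t x.base) ∨
    (s = .hub ∧ {n | x.Sat (.chain n)}.Infinite)}

section BooleanOperations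

variable (x y : Gadget D I ρ) (s : GadgetPoint D)

@[simp] theorem sat_top : (⊤ : Gadget D I ρ).Sat s := trivial
@[simp] theorem not_sat_bot : ¬ (⊥ : Gadget D I ρ).Sat s := id
@[simp] theorem sat_sup : (x ⊔ y).Sat s ↔ x.Sat s ∨ y.Sat s := Iff.rfl
@[simp] theorem sat_inf : (x ⊓ y).Sat s ↔ x.Sat s ∧ y.Sat s := Iff.rfl
@[simp] theorem sat_compl : xᶜ.Sat s ↔ ¬ x.Sat s := Iff.rfl
@[simp] theorem base_top : (⊤ : Gadget D I ρ).base = ⊤ := rfl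
@[simp] theorem base_bot : (⊥ : Gadget D I ρ).base = ⊥ := rfl
@[simp] theorem base_sup : (x ⊔ y).base = x.base ⊔ y.base := rfl
@[simp] theorem base_inf : (x ⊓ y).base = x.base ⊓ y.base := rfl
@[simp] theorem base_compl : xᶜ.base = x.baseᶜ := rfl

end BooleanOperations

theorem mem_diaSet_sup (x y : Gadget D I ρ) (s : GadgetPoint D) :
    s ∈ (x ⊔ y).diaSet ↔ s ∈ x.diaSet ∨ s ∈ y.diaSet := by
  have hrel : (∃ t, Rel I ρ s t ∧ (x ⊔ y).Sat t) ↔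
      (∃ t, Rel I ρ s t ∧ x.Sat t) ∨ ∃ t, Rel I ρ s t ∧ y.Sat t := by
    simp only [sat_sup, and_or_left, exists_or]
  have hsees : (∃ t, s = .tree t ∧ D.sees t (x ⊔ y).base) ↔
      (∃ t, s = .tree t ∧ D.sees t x.base) ∨ ∃ t, s = .tree t ∧ D.sees t y.base := by
    simp only [base_sup, D.sees_sup_iff, and_or_left, exists_or]
  have hinf : {n | (x ⊔ y).Sat (.chain n)}.Infinite ↔
      {n | x.Sat (.chain n)}.Infinite ∨ {n | y.Sat (.chain n)}.Infinite := Set.infinite_union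
  simp only [diaSet, Set.mem_ofPred_eq]
  rw [hrel, hsees, hinf, and_or_left]
  exact iff_of_eq (by ac_rfl)

instance : ModalAlgebra (Gadget D I ρ) where
  dia x := ((x.diaSet, dia x.base) : Set (GadgetPoint D) × A)
  dia_bot := by
    refine eq_of_forall_sat_iff (fun s => iff_of_false ?_ (not_sat_bot s)) dia_bot
    rintro (⟨t, -, ht⟩ | ⟨t, -, ht⟩ | ⟨-, hinf⟩)
    · exact ht
    · exact D.not_sees_bot t ht
    · exact hinf Set.finite_empty
  dia_sup x y := eq_of_forall_sat_iff (mem_diaSet_sup x y) (dia_sup _ _)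

section Dia

variable (x : Gadget D I ρ)

@[simp] theorem base_dia : (dia x).base = dia x.base := rfl

theorem sat_dia (s : GadgetPoint D) : (dia x).Sat s ↔ (∃ t, Rel I ρ s t ∧ x.Sat t) ∨
    (∃ t, s = .tree t ∧ D.sees t x.base) ∨ (s = .hub ∧ {n | x.Sat (.chain n)}.Infinite) :=
  Iff.rfl

@[simp] theorem sat_dia_tree (t : D.Node) : (dia x).Sat (.tree t) ↔
    (∃ s, D.rel t s ∧ x.Sat (.tree s)) ∨ (D.level t = d ∧ x.Sat .hub) ∨ D.sees t x.base := by
  rw [sat_dia]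
  constructor
  · rintro (⟨_, ⟨hrel⟩ | ⟨hlevel⟩, hx⟩ | ⟨_, ⟨⟩, hx⟩ | ⟨⟨⟩, _⟩)
    exacts [.inl ⟨_, hrel, hx⟩, .inr (.inl ⟨hlevel, hx⟩), .inr (.inr hx)]
  · rintro (⟨s, hrel, hx⟩ | ⟨hlevel, hx⟩ | hx)
    exacts [.inl ⟨_, .tree_tree hrel, hx⟩, .inl ⟨_, .tree_hub hlevel, hx⟩,
      .inr (.inl ⟨t, rfl, hx⟩)]

@[simp] theorem sat_dia_link_zero : (dia x).Sat (.link 0) ↔ x.Sat (.tree D.root) := by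
  rw [sat_dia]
  refine ⟨?_, fun hx => .inl ⟨_, .link_root, hx⟩⟩
  rintro (⟨_, hrel, hx⟩ | ⟨_, ⟨⟩, _⟩ | ⟨⟨⟩, _⟩)
  generalize hs : link (D := D) 0 = s at hrel
  cases hrel <;> first | exact hx | cases hs

@[simp] theorem sat_dia_link_succ (i : Fin (d + 2)) : (dia x).Sat (.link i.succ) ↔
    x.Sat (.link i.castSucc) ∨ x.Sat .tip := by
  rw [sat_dia]
  constructor
  · rintro (⟨_, hrel, hx⟩ | ⟨_, ⟨⟩, _⟩ | ⟨⟨⟩, _⟩)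
    generalize hs : link (D := D) i.succ = s at hrel
    cases hrel with
    | link_link j =>
      obtain rfl : i = j := Fin.succ_injective _ (link.inj hs)
      exact .inl hx
    | link_tip => exact .inr hx
    | _ => cases hs
  · rintro (hx | hx)
    exacts [.inl ⟨_, .link_link i, hx⟩, .inl ⟨_, .link_tip i, hx⟩]

@[simp] theorem sat_dia_hub : (dia x).Sat .hub ↔ {n | x.Sat (.chain n)}.Infinite := by
  rw [sat_dia]
  refine ⟨?_, fun hx => .inr (.inr ⟨rfl, hx⟩)⟩
  rintro (⟨_, ⟨⟩, _⟩ | ⟨_, ⟨⟩, _⟩ | ⟨-, hx⟩)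
  exact hx

@[simp] theorem sat_dia_chain (n : ℕ) : (dia x).Sat (.chain n) ↔
    (∃ m < n, x.Sat (.chain m)) ∨ x.Sat (.link (Fin.last _)) ∨
      ((∃ i ∈ I, n = i + 1) ∧ x.Sat .tip) := by
  rw [sat_dia]
  constructor
  · rintro (⟨_, hrel, hx⟩ | ⟨_, ⟨⟩, _⟩ | ⟨⟨⟩, _⟩)
    cases hrel with
    | chain_chain hlt => exact .inl ⟨_, hlt, hx⟩
    | chain_link => exact .inr (.inl hx)
    | chain_tip hi => exact .inr (.inr ⟨⟨_, hi, rfl⟩, hx⟩)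
  · rintro (⟨m, hlt, hx⟩ | hx | ⟨⟨i, hi, rfl⟩, hx⟩)
    exacts [.inl ⟨_, .chain_chain hlt, hx⟩, .inl ⟨_, .chain_link n, hx⟩,
      .inl ⟨_, .chain_tip hi, hx⟩]

@[simp] theorem sat_dia_tip : (dia x).Sat .tip ↔ ρ ∧ x.Sat .tip := by
  rw [sat_dia]
  refine ⟨?_, fun ⟨hρ, hx⟩ => .inl ⟨_, .tip_tip hρ, hx⟩⟩
  rintro (⟨_, hrel, hx⟩ | ⟨_, ⟨⟩, _⟩ | ⟨⟨⟩, _⟩)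
  cases hrel with | tip_tip hρ => exact ⟨hρ, hx⟩

end Dia

theorem base_eval (θ : ℕ → Gadget D I ρ) (φ : Formula) :
    (eval θ φ).base = eval (fun n => (θ n).base) φ :=
  (eval_comp base rfl (fun _ _ => rfl) (fun _ => rfl) θ φ).symm

theorem sat_tip_eval {φ : Formula} (h : Validates (SinglePoint ρ) φ) (θ : ℕ → Gadget D I ρ) :
    (eval θ φ).Sat .tip := by
  let f (x : Gadget D I ρ) : SinglePoint ρ := x.Sat .tip
  have hnec (x : Gadget D I ρ) : f (nec x) = nec (f x) := congrArg Not (propext (sat_dia_tip xᶜ))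
  have hf : eval (fun n => f (θ n)) φ = f (eval θ φ) :=
    eval_comp f rfl (fun _ _ => rfl) hnec θ φ
  exact of_eq_true (hf.symm.trans (h _))

theorem base_ladder (c : Gadget D I ρ) (k : ℕ) : (ladder c k).base = ladder c.base k := by
  induction k with
  | zero => rfl
  | succ k ih => simp [ladder, ih]

/-- The element that holds at the tip and at no other point, up to its component in `A`. -/
def IsTip (c : Gadget D I ρ) : Prop := ∀ s, c.Sat s ↔ s = .tip

section Base

variable (c : Gadget D I ρ) (hA : necBot A d = ⊤)

include hA

theorem base_ladder_eq_bot : (ladder c (d + 2)).base = ⊥ := by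
  rw [base_ladder, ← le_bot_iff]
  refine (ladder_le_diaTop _ _).trans ((diaTop_succ_le _).trans ((diaTop_succ_le _).trans ?_))
  rw [← compl_necBot, hA, compl_top]

theorem base_region : (region c (d + 2)).base = ⊥ := by
  rw [region, base_dia, base_ladder_eq_bot c hA, dia_bot]

theorem base_entrance : (entrance c (d + 2)).base = ⊥ := by
  rw [entrance, base_inf, base_dia, base_region c hA, dia_bot, bot_inf_eq]

theorem base_height (n : ℕ) : (height c (d + 2) n).base = ⊥ := by
  cases n <;> simp [height, base_region c hA]

end Base

namespace IsTip

variable {c : Gadget D I ρ}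

theorem not_sat (hc : IsTip c) {s : GadgetPoint D} (hs : s ≠ .tip) : ¬ c.Sat s := mt (hc s).1 hs

theorem sat_ladder_link (hc : IsTip c) (k : ℕ) (j : Fin (d + 3)) :
    (ladder c k).Sat (.link j) ↔ k ≤ j.val := by
  induction k generalizing j with
  | zero => simp [ladder]
  | succ k ih => cases j using Fin.cases <;> simp [ladder, hc _, ih]

theorem not_sat_ladder_hub (hc : IsTip c) (k : ℕ) : ¬ (ladder c (k + 1)).Sat .hub := by
  simp [ladder, hc _]

theorem not_sat_ladder_tip (hc : IsTip c) (k : ℕ) : ¬ (ladder c (k + 1)).Sat .tip := by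
  simp [ladder, hc _]

theorem not_sat_ladder_tree (hc : IsTip c) (k : ℕ) (t : D.Node) (h : d + 2 ≤ D.level t + k) :
    ¬ (ladder c k).Sat (.tree t) := by
  induction k generalizing t with
  | zero => have := D.level_le t; omega
  | succ k ih =>
    have hnext : (dia (cᶜ ⊓ (ladder c k)ᶜ)).Sat (.tree t) := by
      rw [sat_dia_tree]
      rcases (D.level_le t).lt_or_eq with ht | ht
      · obtain ⟨s, hs⟩ := D.exists_rel t ht
        have := D.level_of_rel _ _ hs
        exact .inl ⟨s, hs, hc.not_sat (by simp), ih s (by omega)⟩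
      · obtain ⟨k, rfl⟩ : ∃ l, k = l + 1 := ⟨k - 1, by omega⟩
        exact .inr (.inl ⟨ht, hc.not_sat (by simp), hc.not_sat_ladder_hub k⟩)
    exact fun hs => hs.2 hnext

theorem not_sat_ladder_chain (hc : IsTip c) (k n : ℕ) : ¬ (ladder c (k + 2)).Sat (.chain n) := by
  have hzero (l : ℕ) : ¬ (ladder c (l + 1)).Sat (.chain 0) := by simp [ladder, hc _]
  rcases n.eq_zero_or_pos with rfl | hn
  · exact hzero _
  · exact fun hs => hs.2 ((sat_dia_chain _ _).2 (.inl ⟨0, hn, hc.not_sat (by simp), hzero k⟩))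

theorem sat_ladder (hc : IsTip c) (s : GadgetPoint D) :
    (ladder c (d + 2)).Sat s ↔ s = .link (Fin.last _) := by
  cases s with
  | tree t => simp [hc.not_sat_ladder_tree (d + 2) t (by omega)]
  | link j =>
    rw [hc.sat_ladder_link, link.injEq, Fin.ext_iff, Fin.val_last]
    omega
  | hub => simp [hc.not_sat_ladder_hub]
  | chain n => simp [hc.not_sat_ladder_chain]
  | tip => simp [hc.not_sat_ladder_tip]

variable (hA : necBot A d = ⊤)

include hA

theorem sat_region (hc : IsTip c) (s : GadgetPoint D) :
    (region c (d + 2)).Sat s ↔ ∃ n, s = .chain n := by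
  cases s with
  | link j =>
    cases j using Fin.cases with
    | zero => simp [region, hc.sat_ladder]
    | succ i => simp [region, hc.sat_ladder, Fin.castSucc_ne_last]
  | _ => simp [region, hc.sat_ladder, base_ladder_eq_bot c hA, D.not_sees_bot]

theorem sat_entrance (hc : IsTip c) (s : GadgetPoint D) :
    (entrance c (d + 2)).Sat s ↔ s = .hub := by
  rw [entrance, sat_inf, sat_compl, hc.sat_region hA]
  cases s with
  | link j => cases j using Fin.cases <;> simp [hc.sat_region hA]
  | hub => simp [hc.sat_region hA, Set.infinite_univ]
  | _ => simp [hc.sat_region hA, base_region c hA, D.not_sees_bot]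

theorem defect_eq_bot (hc : IsTip c) (u : Gadget D I ρ) : defect c (d + 2) u = ⊥ := by
  refine eq_of_forall_sat_iff (fun s => iff_of_false ?_ (not_sat_bot s))
    (by simp [defect, base_entrance c hA])
  rw [defect, sat_inf, hc.sat_entrance hA]
  rintro ⟨rfl, h⟩
  rw [sat_dia_hub] at h
  set w := region c (d + 2) ⊓ u with hw
  have hlink (j) : ¬ w.Sat (.link j) := by simp [hw, hc.sat_region hA]
  have htip : ¬ w.Sat .tip := by simp [hw, hc.sat_region hA]
  obtain ⟨m, hm⟩ := h.nonempty
  classical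
  have hex : ∃ n, w.Sat (.chain n) := ⟨m, hm.1⟩
  have hfirst : (w ⊓ (dia w)ᶜ).Sat (.chain (Nat.find hex)) := by
    refine ⟨Nat.find_spec hex, fun hdia => ?_⟩
    rcases (sat_dia_chain _ _).1 hdia with ⟨n, hn, hwn⟩ | hwn | ⟨-, hwn⟩
    exacts [Nat.find_min hex hn hwn, hlink _ hwn, htip hwn]
  obtain ⟨n, hn, hlt⟩ := h.exists_gt (Nat.find hex)
  exact hn.2 ((sat_dia_chain _ _).2 (.inl ⟨_, hlt, hfirst⟩))

theorem sat_height (hc : IsTip c) (n : ℕ) (s : GadgetPoint D) :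
    (height c (d + 2) n).Sat s ↔ ∃ m, n ≤ m ∧ s = .chain m := by
  induction n generalizing s with
  | zero => simp [height, hc.sat_region hA]
  | succ n ih =>
    rw [height, sat_inf, hc.sat_region hA]
    constructor
    · rintro ⟨⟨m, rfl⟩, h⟩
      simp only [sat_dia_chain, ih] at h
      rcases h with ⟨k, _, k', _, ⟨⟩⟩ | ⟨k, _, ⟨⟩⟩ | ⟨-, k, _, ⟨⟩⟩
      exact ⟨m, by omega, rfl⟩
    · rintro ⟨m, hm, rfl⟩
      exact ⟨⟨m, rfl⟩, (sat_dia_chain _ _).2 (.inl ⟨n, by omega, (ih _).2 ⟨n, le_rfl, rfl⟩⟩)⟩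

theorem sat_marked (hc : IsTip c) (n : ℕ) (s : GadgetPoint D) :
    (marked c (d + 2) n).Sat s ↔ n ∈ I ∧ s = .chain (n + 1) := by
  have hdia (m : ℕ) : (dia c).Sat (.chain m) ↔ ∃ i ∈ I, m = i + 1 := by simp [hc _]
  rw [marked, sat_inf, sat_inf, sat_compl, hc.sat_height hA, hc.sat_height hA]
  constructor
  · rintro ⟨⟨⟨m, hm, rfl⟩, hlt⟩, hs⟩
    obtain ⟨i, hi, rfl⟩ := (hdia m).1 hs
    obtain rfl : i = n := by
      by_contra hne
      exact hlt ⟨i + 1, by omega, rfl⟩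
    exact ⟨hi, rfl⟩
  · rintro ⟨hn, rfl⟩
    refine ⟨⟨⟨n + 1, le_rfl, rfl⟩, ?_⟩, (hdia _).2 ⟨n, hn, rfl⟩⟩
    rintro ⟨m, hm, ⟨⟩⟩
    omega

theorem marked_eq_bot (hc : IsTip c) {n : ℕ} (hn : n ∉ I) : marked c (d + 2) n = ⊥ := by
  refine eq_of_forall_sat_iff (fun s => iff_of_false ?_ (not_sat_bot s))
    (by simp [marked, base_height c hA])
  rw [hc.sat_marked hA]
  exact fun h => hn h.1

end IsTip

section Reach

variable {x : Gadget D I ρ} {m n : ℕ}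

theorem Sat.of_le {y : Gadget D I ρ} {s : GadgetPoint D} (h : x.Sat s) (hxy : x ≤ y) : y.Sat s :=
  hxy.1 h

theorem Sat.reach_mono {s : GadgetPoint D} (h : (reach m x).Sat s) (hmn : m ≤ n) :
    (reach n x).Sat s :=
  h.of_le (reach_le_reach hmn x)

theorem sat_reach_succ_of_sat_dia {s : GadgetPoint D} (h : (dia (reach n x)).Sat s) :
    (reach (n + 1) x).Sat s :=
  .inr h

theorem sat_reach_succ_of_rel {s t : GadgetPoint D} (hst : Rel I ρ s t)
    (ht : (reach n x).Sat t) : (reach (n + 1) x).Sat s :=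
  sat_reach_succ_of_sat_dia (.inl ⟨t, hst, ht⟩)

theorem sat_reach_tree (h : x.Sat .hub) (k : ℕ) (t : D.Node) (ht : D.level t + k = d) :
    (reach (k + 1) x).Sat (.tree t) := by
  induction k generalizing t with
  | zero => exact sat_reach_succ_of_rel (.tree_hub ht) h
  | succ k ih =>
    obtain ⟨s, hs⟩ := D.exists_rel t (by omega)
    have := D.level_of_rel _ _ hs
    exact sat_reach_succ_of_rel (.tree_tree hs) (ih s (by omega))

theorem sat_reach_root (k : ℕ) (t : D.Node) (hk : D.level t = k)
    (ht : (reach n x).Sat (.tree t)) : (reach (n + k) x).Sat (.tree D.root) := by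
  induction k generalizing t n with
  | zero => rwa [D.eq_root t hk] at ht
  | succ k ih =>
    obtain ⟨s, hs⟩ := D.exists_rel_left t (by omega)
    have := D.level_of_rel _ _ hs
    rw [show n + (k + 1) = n + 1 + k by omega]
    exact ih s (by omega) (sat_reach_succ_of_rel (.tree_tree hs) ht)

theorem sat_reach_link {i j : Fin (d + 3)} (hij : i ≤ j) (h : (reach n x).Sat (.link i)) :
    (reach (n + d + 2) x).Sat (.link j) := by
  suffices (reach (n + (j - i)) x).Sat (.link j) from this.reach_mono (by omega)
  induction j using Fin.induction with
  | zero => obtain rfl := Fin.le_zero_iff.1 hij; exact h.reach_mono (by omega)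
  | succ j ih =>
    rcases hij.lt_or_eq with hlt | rfl
    · have hle : i ≤ j.castSucc := Fin.le_castSucc_iff.2 hlt
      refine (sat_reach_succ_of_rel (.link_link j) (ih hle)).reach_mono ?_
      simp only [Fin.le_def, Fin.val_castSucc, Fin.val_succ] at *
      omega
    · exact h.reach_mono (by omega)

theorem sat_reach_of_sat_hub (h : x.Sat .hub) {s : GadgetPoint D} (hs : s ≠ .tip) :
    (reach (2 * d + 5) x).Sat s := by
  have htree (t : D.Node) : (reach (d + 1) x).Sat (.tree t) :=
    (sat_reach_tree h (d - D.level t) t (by have := D.level_le t; omega)).reach_mono (by omega)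
  have hlink (j : Fin (d + 3)) : (reach (d + 2 + d + 2) x).Sat (.link j) :=
    sat_reach_link (Fin.zero_le j) (sat_reach_succ_of_rel .link_root (htree _))
  cases s with
  | tree t => exact (htree t).reach_mono (by omega)
  | link j => exact (hlink j).reach_mono (by omega)
  | hub => exact h.of_le (le_reach _ _)
  | chain n => exact (sat_reach_succ_of_rel (.chain_link n) (hlink _)).reach_mono (by omega)
  | tip => exact absurd rfl hs

theorem sat_reach_hub_of_forall_chain (h : ∀ k, m < k → (reach n x).Sat (.chain k)) :
    (reach (n + 1) x).Sat .hub :=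
  sat_reach_succ_of_sat_dia ((sat_dia_hub _).2 ((Set.Ioi_infinite m).mono h))

theorem sat_reach_hub_of_sat_link {j : Fin (d + 3)} (h : (reach n x).Sat (.link j)) :
    (reach (n + d + 4) x).Sat .hub :=
  sat_reach_hub_of_forall_chain (m := 0) fun k _ =>
    sat_reach_succ_of_rel (.chain_link k) (sat_reach_link (Fin.le_last j) h)

theorem sat_reach_hub {s : GadgetPoint D} (h : x.Sat s) : (reach (2 * d + 5) x).Sat .hub := by
  cases s with
  | tree t =>
    have hroot : (reach (0 + D.level t) x).Sat (.tree D.root) := sat_reach_root _ t rfl h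
    have := D.level_le t
    exact (sat_reach_hub_of_sat_link (sat_reach_succ_of_rel .link_root hroot)).reach_mono (by omega)
  | link j => exact (sat_reach_hub_of_sat_link (n := 0) h).reach_mono (by omega)
  | hub => exact h.of_le (le_reach _ _)
  | chain n =>
    have hchain (k : ℕ) (hk : n < k) : (reach 1 x).Sat (.chain k) :=
      sat_reach_succ_of_rel (n := 0) (.chain_chain hk) h
    exact (sat_reach_hub_of_forall_chain hchain).reach_mono (by omega)
  | tip =>
    have hlink : (reach 1 x).Sat (.link 1) := sat_reach_succ_of_rel (n := 0) (.link_tip 0) h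
    exact (sat_reach_hub_of_sat_link hlink).reach_mono (by omega)

theorem sat_reach {s t : GadgetPoint D} (h : x.Sat s) (ht : t ≠ .tip) :
    (reach (4 * d + 10) x).Sat t :=
  (sat_reach_of_sat_hub (sat_reach_hub h) ht).of_le
    ((reach_le_reach_add _ le_rfl).trans (reach_le_reach (by omega) x))

theorem sat_reach_tip_iff : (reach n x).Sat .tip ↔ x.Sat .tip := by
  induction n with
  | zero => rfl
  | succ n ih => simp only [reach, sat_sup, sat_dia_tip, ih, or_iff_left_iff_imp, and_imp, imp_self,
      implies_true]

end Reach

end Gadget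

/-- The modal depth of a formula: the greatest number of nested boxes. -/
def Formula.depth : Formula → ℕ
  | var _ => 0
  | bot => 0
  | imp φ ψ => max (depth φ) (depth ψ)
  | box φ => depth φ + 1

/-- The class of a formula in the Lindenbaum algebra of a normal logic. -/
abbrev NormalLogic.toLindenbaum (L : NormalLogic) (φ : Formula) : L.Lindenbaum :=
  IsTheory.Lindenbaum.mk _ φ

theorem toLindenbaum_boxBot (L : NormalLogic) (n : ℕ) :
    L.toLindenbaum (.boxBot n) = necBot L.Lindenbaum n := by
  rw [NormalLogic.toLindenbaum, ← IsTheory.Lindenbaum.eval_mk_var, eval_boxBot]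

section BoundDepth

variable (L : NormalLogic) (d : ℕ)

theorem necBot_lindenbaum_boundDepth : necBot (boundDepth L d).Lindenbaum d = ⊤ := by
  rw [← toLindenbaum_boxBot, IsTheory.Lindenbaum.mk_eq_top]
  exact boxBot_mem_boundDepth L d

/-- The Lindenbaum algebra of `boundDepth L d` as the ideal generated by `□ᵈ⊥` in that of `L`. -/
def ofBoundDepth : (boundDepth L d).Lindenbaum → L.Lindenbaum :=
  Quotient.lift (fun φ => L.toLindenbaum (φ.and (.boxBot d))) fun _ _ h =>
    (IsTheory.Lindenbaum.mk_eq_mk _).2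
      ⟨L.2.isTheory.mem_of_imp (fun v => by aesop) (mem_boundDepth.1 h.1),
        L.2.isTheory.mem_of_imp (fun v => by aesop) (mem_boundDepth.1 h.2)⟩

theorem ofBoundDepth_toLindenbaum (φ : Formula) :
    ofBoundDepth L d ((boundDepth L d).toLindenbaum φ) =
      L.toLindenbaum φ ⊓ necBot L.Lindenbaum d := by
  rw [← toLindenbaum_boxBot]
  rfl

theorem ofBoundDepth_bot : ofBoundDepth L d ⊥ = ⊥ :=
  (ofBoundDepth_toLindenbaum L d .bot).trans (bot_inf_eq _)

theorem ofBoundDepth_sup (a b : (boundDepth L d).Lindenbaum) :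
    ofBoundDepth L d (a ⊔ b) = ofBoundDepth L d a ⊔ ofBoundDepth L d b := by
  obtain ⟨φ, rfl⟩ := IsTheory.Lindenbaum.mk_surjective _ a
  obtain ⟨ψ, rfl⟩ := IsTheory.Lindenbaum.mk_surjective _ b
  rw [ofBoundDepth_toLindenbaum, ofBoundDepth_toLindenbaum, ← inf_sup_right]
  exact ofBoundDepth_toLindenbaum L d (φ.or ψ)

end BoundDepth

/-- `ReachesIn R n U` says that a path of length `n` leads from `R` to `U` in the canonical frame
of an algebra. -/
def ReachesIn {A : Type*} [ModalAlgebra A] (R : Set A) : ℕ → Set A → Prop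
  | 0, U => U = R
  | n + 1, U => ∃ V, IsUltrafilter V ∧ ReachesIn R n V ∧ CanonicalRel V U

/-- The nodes of the unravelling up to depth `d` of the canonical frame of `A` at `R`: ultrafilters
reachable from `R`, indexed by their distance, from which the last level can be reached. -/
structure CanonicalNode {A : Type*} [ModalAlgebra A] (R : Set A) (d : ℕ) where
  level : ℕ
  carrier : Set A
  level_le : level ≤ d
  isUltrafilter : IsUltrafilter carrier
  diaTop_mem : diaTop A (d - level) ∈ carrier
  reachesIn : ReachesIn R level carrier

namespace CanonicalNode

variable {A : Type*} [ModalAlgebra A] {R : Set A} {d : ℕ}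

theorem exists_carrier_eq (s : CanonicalNode R d) (hs : s.level < d) {V : Set A}
    (hV : IsUltrafilter V) (hsV : CanonicalRel s.carrier V)
    (hd : diaTop A (d - (s.level + 1)) ∈ V) :
    ∃ t : CanonicalNode R d, t.level = s.level + 1 ∧ t.carrier = V :=
  ⟨⟨s.level + 1, V, hs, hV, hd, s.carrier, s.isUltrafilter, s.reachesIn, hsV⟩, rfl, rfl⟩

theorem exists_canonicalRel (s : CanonicalNode R d) (hs : s.level < d) :
    ∃ t : CanonicalNode R d, t.level = s.level + 1 ∧ CanonicalRel s.carrier t.carrier := by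
  have hd : dia (diaTop A (d - (s.level + 1))) ∈ s.carrier := by
    rw [← diaTop_succ, show d - (s.level + 1) + 1 = d - s.level by omega]
    exact s.diaTop_mem
  obtain ⟨V, hV, hsV, hmem⟩ := ModalAlgebra.exists_canonicalRel s.isUltrafilter hd
  obtain ⟨t, ht, rfl⟩ := s.exists_carrier_eq hs hV hsV hmem
  exact ⟨t, ht, hsV⟩

theorem eq_of_level_eq_zero {s t : CanonicalNode R d} (hs : s.level = 0) (ht : t.level = 0) :
    s = t := by
  obtain ⟨m, U, _, _, _, hU⟩ := s
  obtain ⟨n, V, _, _, _, hV⟩ := t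
  obtain rfl : m = 0 := hs
  obtain rfl : n = 0 := ht
  obtain rfl : U = R := hU
  obtain rfl : V = U := hV
  rfl

theorem exists_canonicalRel_left (t : CanonicalNode R d) (ht : t.level ≠ 0) :
    ∃ s : CanonicalNode R d, t.level = s.level + 1 ∧ CanonicalRel s.carrier t.carrier := by
  obtain ⟨n, U, hn, hU, hd, hRU⟩ := t
  obtain ⟨n, rfl⟩ := Nat.exists_eq_succ_of_ne_zero ht
  obtain ⟨V, hV, hRV, hVU⟩ := hRU
  have hVd : diaTop A (d - n) ∈ V := by
    rw [show d - n = d - (n + 1) + 1 by omega, diaTop_succ]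
    exact hVU _ hd
  exact ⟨⟨n, V, by omega, hV, hVd, hRV⟩, rfl, hVU⟩

end CanonicalNode

variable {L : NormalLogic} {d : ℕ} {R : Set L.Lindenbaum}

/-- The unravelling of the canonical frame of `L` at `R`. The successors that are not nodes satisfy
`□ⁿ⊥` for a sufficiently small `n`, so that they survive as ultrafilters of the Lindenbaum algebra
of `boundDepth L d`. -/
abbrev canonicalTree (hR : IsUltrafilter R) (hRd : diaTop _ d ∈ R) :
    LeveledTree (boundDepth L d).Lindenbaum d where
  Node := CanonicalNode R d
  root := ⟨0, R, d.zero_le, hR, hRd, rfl⟩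
  level := CanonicalNode.level
  rel s t := t.level = s.level + 1 ∧ CanonicalRel s.carrier t.carrier
  sees t a := t.level < d ∧
    dia (ofBoundDepth L d a ⊓ necBot _ (d - (t.level + 1))) ∈ t.carrier
  not_sees_bot t h := by
    rw [ofBoundDepth_bot, bot_inf_eq, dia_bot] at h
    exact t.isUltrafilter.bot_notMem h.2
  sees_sup_iff t a b := by
    rw [ofBoundDepth_sup, inf_sup_right, dia_sup, t.isUltrafilter.sup_mem_iff, and_or_left]
  level_le := CanonicalNode.level_le
  level_of_rel _ _ h := h.1
  exists_rel := CanonicalNode.exists_canonicalRel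
  eq_root _ ht := CanonicalNode.eq_of_level_eq_zero ht rfl
  exists_rel_left := CanonicalNode.exists_canonicalRel_left

variable {hR : IsUltrafilter R} {hRd : diaTop _ d ∈ R} {I : Set ℕ} {ρ : Prop}

/-- The canonical valuation in the gadget of the canonical tree. -/
def canonicalVal (hR : IsUltrafilter R) (hRd : diaTop _ d ∈ R) (I : Set ℕ) (ρ : Prop) (n : ℕ) :
    Gadget (canonicalTree hR hRd) I ρ :=
  (({s | ∃ t : CanonicalNode R d, s = .tree t ∧ L.toLindenbaum (.var n) ∈ t.carrier},
    (boundDepth L d).toLindenbaum (.var n)) : Set (GadgetPoint _) × _)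

theorem sat_canonicalVal {n : ℕ} {t : CanonicalNode R d} :
    (canonicalVal hR hRd I ρ n).Sat (.tree t) ↔ L.toLindenbaum (.var n) ∈ t.carrier := by
  constructor
  · rintro ⟨_, ⟨⟩, hmem⟩
    exact hmem
  · exact fun hmem => ⟨t, rfl, hmem⟩

theorem base_eval_canonicalVal (ψ : Formula) :
    (eval (canonicalVal hR hRd I ρ) ψ).base = (boundDepth L d).toLindenbaum ψ := by
  rw [Gadget.base_eval]
  exact IsTheory.Lindenbaum.eval_mk_var _ ψ

theorem sat_dia_canonicalTree_iff {x : Gadget (canonicalTree hR hRd) I ρ} {ψ : Formula}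
    (hbase : x.base = (boundDepth L d).toLindenbaum ψ) {t : CanonicalNode R d} (ht : t.level < d)
    (hx : ∀ s : CanonicalNode R d, s.level = t.level + 1 →
      (x.Sat (.tree s) ↔ L.toLindenbaum ψ ∈ s.carrier)) :
    (dia x).Sat (.tree t) ↔ dia (L.toLindenbaum ψ) ∈ t.carrier := by
  rw [Gadget.sat_dia_tree, hbase]
  constructor
  · rintro (⟨s, hs, hxs⟩ | ⟨hlevel, -⟩ | hsees)
    · exact hs.2 _ ((hx s hs.1).1 hxs)
    · exact absurd hlevel ht.ne
    · refine t.isUltrafilter.mem_of_le (dia_mono ?_) hsees.2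
      rw [ofBoundDepth_toLindenbaum]
      exact inf_le_left.trans inf_le_left
  · intro hmem
    obtain ⟨V, hV, htV, hψV⟩ := exists_canonicalRel t.isUltrafilter hmem
    by_cases hVd : diaTop _ (d - (t.level + 1)) ∈ V
    · obtain ⟨s, hs, rfl⟩ := t.exists_carrier_eq ht hV htV hVd
      exact .inl ⟨s, ⟨hs, htV⟩, (hx s hs).2 hψV⟩
    · rw [← compl_necBot, hV.compl_mem_iff, not_not] at hVd
      refine .inr (.inr ⟨ht, htV _ ?_⟩)
      have hle : d - (t.level + 1) ≤ d := Nat.sub_le ..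
      rw [ofBoundDepth_toLindenbaum, inf_assoc, inf_eq_right.2 (necBot_mono hle),
        hV.inf_mem_iff]
      exact ⟨hψV, hVd⟩

theorem sat_eval_canonicalVal (ψ : Formula) (t : CanonicalNode R d) (h : ψ.depth + t.level ≤ d) :
    (eval (canonicalVal hR hRd I ρ) ψ).Sat (.tree t) ↔ L.toLindenbaum ψ ∈ t.carrier := by
  induction ψ generalizing t with
  | var n => exact sat_canonicalVal
  | bot => exact iff_of_false id t.isUltrafilter.bot_notMem
  | imp φ ψ hφ hψ =>
    rw [Formula.depth] at h
    rw [eval_imp, NormalLogic.toLindenbaum, IsTheory.Lindenbaum.mk_imp,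
      t.isUltrafilter.sup_mem_iff, t.isUltrafilter.compl_mem_iff, Gadget.sat_sup,
      Gadget.sat_compl, hφ t (by omega), hψ t (by omega)]
  | box ψ ih =>
    rw [Formula.depth] at h
    rw [eval_box, NormalLogic.toLindenbaum, IsTheory.Lindenbaum.mk_box, nec, nec,
      t.isUltrafilter.compl_mem_iff, Gadget.sat_compl, not_iff_not]
    refine sat_dia_canonicalTree_iff (ψ := ψ.neg) ?_ (by omega) fun s hs => ?_
    · rw [Gadget.base_compl, base_eval_canonicalVal]
      rfl
    · rw [Gadget.sat_compl, ih s (by omega), ← s.isUltrafilter.compl_mem_iff]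
      rfl

theorem exists_leveledTree_not_sat {L : NormalLogic} {φ : Formula} (hφ : φ ∉ L.1)
    (hφd : φ ∈ (boundDepth L φ.depth).1) :
    ∃ D : LeveledTree (boundDepth L φ.depth).Lindenbaum φ.depth, ∀ (I : Set ℕ) (ρ : Prop),
      ∃ θ : ℕ → Gadget D I ρ, ¬ (eval θ φ).Sat (.tree D.root) := by
  have hne : (L.toLindenbaum φ)ᶜ ≠ ⊥ := fun h =>
    hφ ((IsTheory.Lindenbaum.mk_eq_top _).1 (compl_eq_bot.1 h))
  obtain ⟨R, hR, hmem⟩ := exists_isUltrafilter_mem hne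
  have hφR := (hR.compl_mem_iff _).1 hmem
  have hRd : diaTop _ φ.depth ∈ R := by
    rw [← compl_necBot, hR.compl_mem_iff, ← toLindenbaum_boxBot]
    have hle : L.toLindenbaum (.boxBot φ.depth) ≤ L.toLindenbaum φ := mem_boundDepth.1 hφd
    exact fun h => hφR (hR.mem_of_le hle h)
  exact ⟨canonicalTree hR hRd, fun I ρ => ⟨canonicalVal hR hRd I ρ, fun h =>
    hφR ((sat_eval_canonicalVal φ _ le_rfl).1 h)⟩⟩

namespace Formula

/-- The formula obtained by renaming the variables so that the first two do not occur. -/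
def shift (φ : Formula) : Formula := φ.subst fun n => var (n + 2)

/-- The disjunction of a list of formulas. -/
def any : List Formula → Formula
  | [] => bot
  | φ :: l => φ.or (any l)

end Formula

/-- The assignment that extends `θ`, moved by two, by values for the first two variables. -/
def extendVal {M : Type*} (a b : M) (θ : ℕ → M) : ℕ → M
  | 0 => a
  | 1 => b
  | n + 2 => θ n

namespace ModalAlgebra

variable {M : Type*} [ModalAlgebra M] (θ : ℕ → M)

@[simp] theorem eval_shift (a b : M) (φ : Formula) :
    eval (extendVal a b θ) φ.shift = eval θ φ :=
  eval_subst ..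

theorem eval_extendVal_of_varBound_le_one {φ : Formula} (hφ : φ.varBound ≤ 1) (a b : M) :
    eval (extendVal a b θ) φ = eval (fun _ => a) φ :=
  eval_congr fun n hn => by
    obtain rfl : n = 0 := by omega
    rfl

theorem eval_le_eval_any {φ : Formula} {l : List Formula} (h : φ ∈ l) :
    eval θ φ ≤ eval θ (.any l) := by
  induction h with
  | head =>
    rw [Formula.any, eval_or]
    exact le_sup_left
  | tail _ _ ih =>
    rw [Formula.any, eval_or]
    exact ih.trans le_sup_right

theorem exists_inf_eval_ne_bot {a : M} {l : List Formula} (h : a ⊓ eval θ (.any l) ≠ ⊥) :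
    ∃ φ ∈ l, a ⊓ eval θ φ ≠ ⊥ := by
  induction l with
  | nil => exact absurd (inf_bot_eq a) h
  | cons φ l ih =>
    rw [Formula.any, eval_or, inf_sup_left, ne_eq, sup_eq_bot_iff, not_and_or] at h
    rw [List.exists_mem_cons_iff]
    exact h.imp id ih

theorem exists_ne_bot_ne_top_of_eval_ne_top (hM : nec (⊥ : M) = ⊥) {φ : Formula}
    (hφ : Validates (SinglePoint True) φ) (h : eval θ φ ≠ ⊤) :
    ∃ j < φ.varBound, θ j ≠ ⊥ ∧ θ j ≠ ⊤ := by
  by_contra! hθ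
  let η (j : ℕ) : SinglePoint True := θ j = ⊤
  have hη : ∀ j < φ.varBound, θ j = SinglePoint.toAlgebra M (η j) := by
    intro j hj
    by_cases htop : θ j = ⊤
    · rw [show η j = ⊤ from eq_true htop, SinglePoint.toAlgebra_top, htop]
    · rw [show η j = ⊥ from eq_false htop, SinglePoint.toAlgebra_bot]
      exact not_imp_comm.1 (hθ j hj) htop
  apply h
  rw [eval_congr hη, SinglePoint.eval_toAlgebra_of_reflexive hM, hφ, SinglePoint.toAlgebra_top]

end ModalAlgebra

section InterLogic

variable {L : NormalLogic} {G M : Type*} [ModalAlgebra G] [ModalAlgebra M] {φ ψ : Formula}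

/-- The intersection of a normal logic and the logic of an algebra. -/
def interLogic (L : NormalLogic) (G : Type*) [ModalAlgebra G] : NormalLogic :=
  ⟨⋂₀ {L.1, (rootLogic (⊤ : G)).1}, isNormalLogic_sInter (by
    rintro _ (rfl | rfl)
    exacts [L.2, (rootLogic ⊤).2])⟩

theorem mem_interLogic : φ ∈ (interLogic L G).1 ↔ φ ∈ L.1 ∧ Validates G φ := by
  rw [← mem_rootLogic_top, ← Set.mem_inter_iff, ← Set.sInter_pair]
  rfl

theorem interLogic_le : interLogic L G ≤ L := fun _ h => (mem_interLogic.1 h).1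

theorem compl_eval_le_of_or_mem (hM : ValidatesLogic M (interLogic L G))
    (h : φ.or ψ ∈ (interLogic L G).1) (θ : ℕ → M) : (eval θ φ)ᶜ ≤ eval θ ψ := by
  rw [← compl_sup_eq_top_iff, compl_compl, ← eval_or, hM _ h]

end InterLogic

section Degree

variable {A : Type*} [ModalAlgebra A] {d : ℕ} {D : LeveledTree A d} {ρ : Prop} {L : NormalLogic}
  {I : Set ℕ} {φ : Formula}

theorem ne_tip_of_not_sat_eval (hρ : ValidatesLogic (SinglePoint ρ) L) (hφ : φ ∈ L.1)
    {θ : ℕ → Gadget D I ρ} {s : GadgetPoint D} (hs : ¬ (eval θ φ).Sat s) : s ≠ .tip := by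
  rintro rfl
  exact hs (Gadget.sat_tip_eval (hρ φ hφ) θ)

theorem or_mem_interLogic_gadget (hA : ValidatesLogic A L) (hφ : φ ∈ L.1) {ψ : Formula}
    (h : ∀ (θ : ℕ → Gadget D I ρ) s, ¬ (eval θ φ).Sat s → (eval θ ψ).Sat s) :
    φ.or ψ ∈ (interLogic L (Gadget D I ρ)).1 := by
  refine mem_interLogic.2 ⟨L.2.isTheory.mem_of_imp (fun v => by aesop) hφ, fun θ => ?_⟩
  rw [eval_or]
  refine Gadget.eq_of_forall_sat_iff (fun s => iff_of_true ?_ (Gadget.sat_top s)) ?_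
  · rw [Gadget.sat_sup, or_iff_not_imp_left]
    exact h θ s
  · rw [Gadget.base_sup, Gadget.base_eval, hA φ hφ, top_sup_eq, Gadget.base_top]

/-- Formulas `π` and `c` in the variable `p₀` such that `c` defines the tip of a gadget over `D`
whenever `π` holds somewhere, and such that at every point where a theorem of `L` fails, one of
finitely many substitution instances of `π` holds. -/
structure IsDetector (L : NormalLogic) (D : LeveledTree A d) (ρ : Prop) (π c : Formula) :
    Prop where
  varBound_left : π.varBound ≤ 1
  varBound_right : c.varBound ≤ 1
  isTip : ∀ {I : Set ℕ} {θ : ℕ → Gadget D I ρ} {s}, (eval θ π).Sat s → Gadget.IsTip (eval θ c)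
  exists_list : ∀ φ ∈ L.1, ∃ l : List Formula, ∀ {I : Set ℕ} {θ : ℕ → Gadget D I ρ} {s},
    ¬ (eval θ φ).Sat s → ∃ ψ ∈ l, (eval (fun _ => eval θ ψ) π).Sat s

namespace IsDetector

variable {π c : Formula} (h : IsDetector L D ρ π c) (hA : ValidatesLogic A L) (hφ : φ ∈ L.1)

include h hA hφ

theorem exists_inf_ne_bot {M : Type*} [ModalAlgebra M]
    (hM : ValidatesLogic M (interLogic L (Gadget D I ρ))) {θ : ℕ → M} (hθ : eval θ φ ≠ ⊤) :
    ∃ q : M, (eval θ φ)ᶜ ⊓ eval (fun _ => q) π ≠ ⊥ := by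
  obtain ⟨l, hl⟩ := h.exists_list φ hφ
  let l' : List Formula := l.map fun ψ => π.subst fun _ => ψ
  have hmem : φ.or (.any l') ∈ (interLogic L (Gadget D I ρ)).1 := by
    refine or_mem_interLogic_gadget hA hφ fun η s hs => ?_
    obtain ⟨ψ, hψ, hπ⟩ := hl hs
    rw [← eval_subst η π fun _ => ψ] at hπ
    exact hπ.of_le (eval_le_eval_any η (List.mem_map_of_mem hψ))
  have hne : (eval θ φ)ᶜ ⊓ eval θ (.any l') ≠ ⊥ := by
    rwa [inf_eq_left.2 (compl_eval_le_of_or_mem hM hmem θ), ne_eq, compl_eq_bot]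
  obtain ⟨_, hψ, hne⟩ := exists_inf_eval_ne_bot θ hne
  obtain ⟨ψ, -, rfl⟩ := List.mem_map.1 hψ
  exact ⟨eval θ ψ, by rwa [eval_subst] at hne⟩

variable (hρ : ValidatesLogic (SinglePoint ρ) L)

include hρ

theorem or_imp_mem {ψ : Formula} (hψ : ∀ θ : ℕ → Gadget D I ρ, Gadget.IsTip (eval θ c) →
    ∀ s ≠ .tip, (eval θ ψ).Sat s) : φ.or (π.imp ψ) ∈ (interLogic L (Gadget D I ρ)).1 := by
  refine or_mem_interLogic_gadget hA hφ fun θ s hs => ?_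
  rw [eval_imp, Gadget.sat_sup, Gadget.sat_compl, ← imp_iff_not_or]
  exact fun hπ => hψ θ (h.isTip hπ) s (ne_tip_of_not_sat_eval hρ hφ hs)

variable (hd : necBot A d = ⊤)

include hd

theorem or_reach_entrance_mem :
    φ.or (π.imp (.reach (4 * d + 10) (.entrance c (d + 2)))) ∈
      (interLogic L (Gadget D I ρ)).1 :=
  h.or_imp_mem hA hφ hρ fun θ hc s hs => by
    rw [eval_reach, eval_entrance]
    exact Gadget.sat_reach ((hc.sat_entrance hd .hub).2 rfl) hs

theorem or_neg_reach_defect_mem (u : Formula) :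
    φ.or (π.imp (Formula.reach (4 * d + 10) (.defect c (d + 2) u)).neg) ∈
      (interLogic L (Gadget D I ρ)).1 :=
  h.or_imp_mem hA hφ hρ fun θ hc s _ => by
    rw [eval_neg, eval_reach, eval_defect, hc.defect_eq_bot hd, reach_bot, compl_bot]
    exact Gadget.sat_top s

theorem or_neg_reach_marked_mem {n : ℕ} (hn : n ∉ I) :
    φ.or (π.imp (Formula.reach (4 * d + 10) (.marked c (d + 2) n)).neg) ∈
      (interLogic L (Gadget D I ρ)).1 :=
  h.or_imp_mem hA hφ hρ fun θ hc s _ => by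
    rw [eval_neg, eval_reach, eval_marked, hc.marked_eq_bot hd hn, reach_bot, compl_bot]
    exact Gadget.sat_top s

omit hφ in
theorem sameVBAOs_interLogic (I : Set ℕ) : SameVBAOs.{u} L (interLogic L (Gadget D I ρ)) := by
  intro M _ hM
  refine ⟨fun hL φ hφ => hL φ (interLogic_le hφ), fun hL φ hφ θ => ?_⟩
  by_contra hne
  obtain ⟨q, hq⟩ := h.exists_inf_ne_bot hA hφ hL hne
  have hshift : φ.shift ∈ L.1 := L.2.substitution _ φ hφ
  have hentrance := compl_eval_le_of_or_mem hL (h.or_reach_entrance_mem hA hshift hρ hd)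
    (extendVal q ⊥ θ)
  have hdefect (u : M) := compl_eval_le_of_or_mem hL
    (h.or_neg_reach_defect_mem hA hshift hρ hd (.var 1)) (extendVal q u θ)
  simp only [eval_shift, eval_imp, eval_neg, eval_reach, eval_entrance, eval_defect, eval_var,
    eval_extendVal_of_varBound_le_one _ h.varBound_left,
    eval_extendVal_of_varBound_le_one _ h.varBound_right, ← inf_le_iff_le_compl_sup]
    at hentrance hdefect
  exact hq (eq_bot_of_van_benthem hM inf_le_left hentrance hdefect)

theorem subset_of_interLogic_eq {I J : Set ℕ}
    (href : ∃ θ : ℕ → Gadget D I ρ, ¬ (eval θ φ).Sat (.tree D.root))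
    (hIJ : interLogic L (Gadget D I ρ) = interLogic L (Gadget D J ρ)) : I ⊆ J := by
  intro n hnI
  by_contra hnJ
  have hshift : φ.shift ∈ L.1 := L.2.substitution _ φ hφ
  obtain ⟨θ, hθ⟩ := href
  obtain ⟨l, hl⟩ := h.exists_list φ hφ
  obtain ⟨ψ, -, hπ⟩ := hl hθ
  have hmarked : (reach (4 * d + 10) (marked (eval (fun _ => eval θ ψ) c) (d + 2) n)).Sat
      (.tree D.root) :=
    Gadget.sat_reach (((h.isTip hπ).sat_marked hd n _).2 ⟨hnI, rfl⟩) (by simp)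
  have hmem := h.or_neg_reach_marked_mem hA hshift hρ hd hnJ
  rw [← hIJ] at hmem
  have hle := compl_eval_le_of_or_mem (fun _ hχ => (mem_interLogic.1 hχ).2) hmem
    (extendVal (eval θ ψ) ⊥ θ)
  simp only [eval_shift, eval_imp, eval_neg, eval_reach, eval_marked,
    eval_extendVal_of_varBound_le_one _ h.varBound_left,
    eval_extendVal_of_varBound_le_one _ h.varBound_right, ← inf_le_iff_le_compl_sup] at hle
  have hsat : ((eval θ φ)ᶜ ⊓ eval (fun _ => eval θ ψ) π).Sat (.tree D.root) := ⟨hθ, hπ⟩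
  exact hsat.of_le hle hmarked

theorem two_pow_le_degree
    (href : ∀ I : Set ℕ, ∃ θ : ℕ → Gadget D I ρ, ¬ (eval θ φ).Sat (.tree D.root)) :
    2 ^ Cardinal.aleph0 ≤ degreeVIncompleteness.{u} L := by
  let f (I : Set ℕ) : {L' : NormalLogic // SameVBAOs.{u} L L'} :=
    ⟨interLogic L (Gadget D I ρ), h.sameVBAOs_interLogic hA hρ hd I⟩
  have hf : Function.Injective f := fun I J hIJ => by
    have hIJ' := congrArg Subtype.val hIJ
    exact (h.subset_of_interLogic_eq hA hφ hρ hd (href I) hIJ').antisymm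
      (h.subset_of_interLogic_eq hA hφ hρ hd (href J) hIJ'.symm)
  have := Cardinal.mk_le_of_injective hf
  rwa [Cardinal.mk_set, Cardinal.mk_nat] at this

end IsDetector

end Degree

/-- A coding of formulas by natural numbers. -/
def Formula.code : Formula → ℕ
  | var n => 4 * n
  | bot => 1
  | imp φ ψ => 4 * Nat.pair (code φ) (code ψ) + 2
  | box φ => 4 * code φ + 3

theorem Formula.code_injective : Function.Injective Formula.code := by
  intro φ ψ h
  induction φ generalizing ψ with
  | var n => cases ψ <;> grind [code]
  | bot => cases ψ <;> grind [code]
  | imp φ₁ φ₂ h₁ h₂ => cases ψ <;> grind [code, Nat.pair_eq_pair]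
  | box φ ih => cases ψ <;> grind [code]

theorem degree_le_two_pow (L : NormalLogic) :
    degreeVIncompleteness.{u} L ≤ 2 ^ Cardinal.aleph0 := by
  have hcount : Cardinal.mk Formula ≤ Cardinal.aleph0 := by
    have := Cardinal.mk_le_of_injective Formula.code_injective
    rwa [Cardinal.mk_nat] at this
  calc degreeVIncompleteness.{u} L ≤ Cardinal.mk NormalLogic := Cardinal.mk_subtype_le _
    _ ≤ Cardinal.mk (Set Formula) := Cardinal.mk_subtype_le _
    _ = 2 ^ Cardinal.mk Formula := Cardinal.mk_set
    _ ≤ 2 ^ Cardinal.aleph0 := Cardinal.power_le_power_left two_ne_zero hcount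

namespace Formula

/-- Within `n` steps there is a point at which `φ` holds, and one from which no such point can be
reached within `n` steps. -/
def varies (n : ℕ) (φ : Formula) : Formula := (reach n φ).and (reach n (reach n φ).neg)

theorem varBound_reach (n : ℕ) (φ : Formula) : (reach n φ).varBound = φ.varBound := by
  induction n with
  | zero => rfl
  | succ n ih => simp [reach, Formula.or, neg, dia, varBound, ih]

end Formula

theorem ModalAlgebra.eval_varies {M : Type*} [ModalAlgebra M] (θ : ℕ → M) (n : ℕ) (φ : Formula) :
    eval θ (.varies n φ) = reach n (eval θ φ) ⊓ reach n (reach n (eval θ φ))ᶜ := by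
  simp only [Formula.varies, eval_and, eval_reach, eval_neg]

namespace Gadget

variable {A : Type*} [ModalAlgebra A] {d : ℕ} {D : LeveledTree A d} {I : Set ℕ} {ρ : Prop}

theorem sat_dia_top {s : GadgetPoint D} (hs : s ≠ .tip) : (dia (⊤ : Gadget D I ρ)).Sat s := by
  cases s with
  | tree t =>
    rcases (D.level_le t).lt_or_eq with ht | ht
    · exact (sat_dia_tree _ t).2 (.inl ((D.exists_rel t ht).imp fun _ hs => ⟨hs, trivial⟩))
    · exact (sat_dia_tree _ t).2 (.inr (.inl ⟨ht, trivial⟩))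
  | link j => cases j using Fin.cases <;> simp
  | hub => simp [Set.infinite_univ]
  | chain n => simp
  | tip => exact absurd rfl hs

theorem isTip_necBot_one : IsTip (necBot (Gadget D I False) 1) := by
  intro s
  rw [necBot_succ, necBot_zero, nec, compl_bot, sat_compl]
  rcases eq_or_ne s .tip with rfl | hs
  · simp
  · exact iff_of_false (not_not.2 (sat_dia_top hs)) hs

theorem sat_varies {θ : ℕ → Gadget D I ρ} {φ : Formula} {s t : GadgetPoint D}
    (ht : (eval θ φ).Sat t) (htip : ¬ (eval θ φ).Sat .tip) (hs : s ≠ .tip) :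
    (eval θ (.varies (4 * d + 10) φ)).Sat s := by
  rw [eval_varies]
  exact ⟨sat_reach ht hs, sat_reach (mt sat_reach_tip_iff.1 htip) hs⟩

section Subsingleton

variable [Subsingleton A]

theorem exists_sat_of_ne_bot {x : Gadget D I ρ} (hx : x ≠ ⊥) : ∃ t, x.Sat t := by
  by_contra! h
  exact hx (eq_of_forall_sat_iff (fun t => iff_of_false (h t) (not_sat_bot t))
    (Subsingleton.elim _ _))

theorem nec_bot_of_reflexive : nec (⊥ : Gadget D I True) = ⊥ := by
  rw [nec, compl_bot, compl_eq_bot]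
  refine eq_of_forall_sat_iff (fun s => iff_of_true ?_ (sat_top s)) (Subsingleton.elim _ _)
  rcases eq_or_ne s .tip with rfl | hs
  · simp
  · exact sat_dia_top hs

theorem isTip_compl_reach {θ : ℕ → Gadget D I ρ} {φ : Formula} {s : GadgetPoint D}
    (h : (eval θ (.varies (4 * d + 10) φ)).Sat s) :
    IsTip (reach (4 * d + 10) (eval θ φ))ᶜ := by
  rw [eval_varies, sat_inf] at h
  have hne {x : Gadget D I ρ} (hx : (reach (4 * d + 10) x).Sat s) : ∃ t, x.Sat t :=
    exists_sat_of_ne_bot fun hbot => by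
      rw [hbot, reach_bot] at hx
      exact hx
  obtain ⟨t, ht⟩ := hne h.1
  have htip {r : GadgetPoint D} (hr : (reach (4 * d + 10) (eval θ φ))ᶜ.Sat r) : r = .tip :=
    by_contra fun hne => hr (sat_reach ht hne)
  obtain ⟨r, hr⟩ := hne h.2
  exact fun r' => ⟨htip, fun hr' => hr' ▸ htip hr ▸ hr⟩

theorem exists_sat_varies {φ : Formula} (hφ : Validates (SinglePoint True) φ)
    {θ : ℕ → Gadget D I True} {s : GadgetPoint D} (hs : ¬ (eval θ φ).Sat s) :
    ∃ j < φ.varBound, ∃ ψ ∈ [Formula.var j, .neg (.var j)],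
      (eval θ (.varies (4 * d + 10) ψ)).Sat s := by
  have hstip : s ≠ .tip := by
    rintro rfl
    exact hs (sat_tip_eval hφ θ)
  obtain ⟨j, hj, hbot, htop⟩ := exists_ne_bot_ne_top_of_eval_ne_top θ nec_bot_of_reflexive hφ
    fun h => hs (h ▸ sat_top s)
  refine ⟨j, hj, ?_⟩
  by_cases htip : (θ j).Sat .tip
  · obtain ⟨t, ht⟩ := exists_sat_of_ne_bot (mt compl_eq_bot.1 htop)
    have htip' : ¬ (eval θ (.neg (.var j))).Sat .tip := by
      rwa [eval_neg, eval_var, sat_compl, not_not]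
    exact ⟨.neg (.var j), by simp, sat_varies (t := t) (by rwa [eval_neg]) htip' hstip⟩
  · obtain ⟨t, ht⟩ := exists_sat_of_ne_bot hbot
    exact ⟨.var j, by simp, sat_varies ht htip hstip⟩

end Subsingleton

end Gadget

section Detectors

variable {A : Type*} [ModalAlgebra A] {d : ℕ}

theorem isDetector_of_irreflexive (L : NormalLogic) (D : LeveledTree A d) :
    IsDetector L D False .top (.boxBot 1) where
  varBound_left := Nat.zero_le _
  varBound_right := Nat.zero_le _
  isTip _ := by
    rw [eval_boxBot]
    exact Gadget.isTip_necBot_one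
  exists_list _ _ := ⟨[.bot], fun {_ _} s _ => ⟨.bot, List.mem_singleton_self _, by
    rw [eval_top]
    exact Gadget.sat_top s⟩⟩

theorem isDetector_of_reflexive [Subsingleton A] {L : NormalLogic}
    (hρ : ValidatesLogic (SinglePoint True) L) (D : LeveledTree A d) :
    IsDetector L D True (.varies (4 * d + 10) (.var 0))
      (Formula.reach (4 * d + 10) (.var 0)).neg where
  varBound_left := by
    simp [Formula.varies, Formula.and, Formula.neg, Formula.varBound, Formula.varBound_reach]
  varBound_right := by simp [Formula.neg, Formula.varBound, Formula.varBound_reach]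
  isTip h := by
    rw [eval_neg, eval_reach]
    exact Gadget.isTip_compl_reach h
  exists_list φ hφ := by
    refine ⟨(List.range φ.varBound).flatMap fun j => [.var j, .neg (.var j)], fun {_ _ _} hs => ?_⟩
    obtain ⟨j, hj, ψ, hψ, hvaries⟩ := Gadget.exists_sat_varies (hρ φ hφ) hs
    rw [eval_varies] at hvaries
    refine ⟨ψ, List.mem_flatMap.2 ⟨j, List.mem_range.2 hj, hψ⟩, ?_⟩
    rwa [eval_varies]

end Detectors

theorem subsingleton_lindenbaum {L : NormalLogic} (h : .bot ∈ L.1) :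
    Subsingleton L.Lindenbaum :=
  subsingleton_of_bot_eq_top ((IsTheory.Lindenbaum.mk_eq_top L.2.isTheory).2 h)

end ModalLogic

open ModalLogic ModalAlgebra in
theorem theorem7 (L : ModalLogic.NormalLogic) (hcons : ModalLogic.IsConsistent L)
    (hL : ¬ ModalLogic.IsJoinSplitting L) :
    ModalLogic.degreeVIncompleteness.{u} L = 2 ^ Cardinal.aleph0 := by
  refine le_antisymm (degree_le_two_pow L) ?_
  obtain ⟨L₀, hL₀, hne⟩ := exists_not_le_of_not_isJoinSplitting hL
  obtain ⟨φ, hφ, hφ₀⟩ := Set.not_subset.1 hne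
  have hle : L ≤ boundDepth L₀ φ.depth := le_boundDepth_of_splittings hL₀ φ.depth
  obtain ⟨D, href⟩ := exists_leveledTree_not_sat hφ₀ (hle hφ)
  have hA : ValidatesLogic (boundDepth L₀ φ.depth).Lindenbaum L := fun ψ hψ =>
    validatesLogic_lindenbaum _ ψ (hle hψ)
  have hd := necBot_lindenbaum_boundDepth L₀ φ.depth
  rcases validatesLogic_singlePoint_of_splittings hcons hL₀ with hρ | ⟨hρ, hbot⟩
  · exact (isDetector_of_irreflexive L D).two_pow_le_degree hA hφ hρ hd fun I => href I False
  · have := subsingleton_lindenbaum (hbot φ.depth)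
    exact (isDetector_of_reflexive hρ D).two_pow_le_degree hA hφ hρ hd fun I => href I True
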